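/- **Setting.** Let $k$ be a field of characteristic $0$, $L/k$ a quadratic field extension, $\tau\colon x\mapsto\bar x$ the nontrivial automorphism of $L/k$, and $n\ge 2$. Let $J\in M_{2n}(k)$ be the block-diagonal matrix with $n$ diagonal blocks $\begin{pmatrix}0&-1\\1&0\end{pmatrix}$ (the matrix of a skew-hermitian form $h$ on $L^{2n}$ of maximal Witt index), and let $$G(k)=\mathrm{SU}_{2n}(L,h)=\{X\in \mathrm{SL}_{2n}(L)\;:\;X^*JX=J\},$$ where $X^*$ is the conjugate transpose. Its relative root system $\Phi_k$, with respect to the torus of diagonal matrices $\mathrm{diag}(t_1,t_1^{-1},\dots,t_n,t_n^{-1})$, is of type $C_n$; with $\alpha_i$ the character $t_i$ $(1\le i\le n)$, it consists of the long roots $\pm2\alpha_i$ and the short roots $\pm\alpha_i\pm\alpha_j$ $(i\ne j)$. For a $k$-algebra $R$ put $V_\alpha(R)=R$ if $\alpha$ is long and $V_\alpha(R)=R\otimes_kL$ if $\alpha$ is short. The root subgroup maps $X_\alpha\colon V_\alpha(k)\to G(k)$ are, with $E_{pq}(x)$ the matrix with $x$ in position $(p,q)$ and $0$ elsewhere, $$X_{2\alpha_i}(x)=1+E_{2i-1,2i}(x),\qquad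 X_{-2\alpha_i}(x)=1+E_{2i,2i-1}(x)\qquad(x\in k),$$ $$X_{\alpha_i-\alpha_j}(x)=1+E_{2i-1,2j-1}(x)-E_{2j,2i}(\bar x)\qquad(i\neq j,\ x\in L),$$ $$X_{\alpha_i+\alpha_j}(x)=1+E_{2i-1,2j}(x)+E_{2j-1,2i}(\bar x),\quad X_{-\alpha_i-\alpha_j}(x)=1+E_{2j,2i-1}(x)+E_{2i,2j-1}(\bar x)\qquad(i<j,\ x\in L).$$ **Proposition.** Let $K$ be an algebraically closed field of characteristic $0$, let $\rho\colon G(k)\to \mathrm{GL}_m(K)$ be an arbitrary (abstract) group homomorphism, and let $H\subseteq\mathrm{GL}_m(K)$ be the Zariski closure of $\rho(G(k))$. There exist a commutative finite-dimensional $K$-algebra $A$ (possibly $0$), a ring homomorphism $f\colon k\to A$ whose image is Zariski-dense in the affine space $A$, and for every $\alpha\in\Phi_k$ a regular map $\psi_\alpha\colon V_\alpha(A)\to H$ such that $$\psi_\alpha\circ V_\alpha(f)=\rho\circ X_\alpha .$$ Here $A$ is regarded as a $k$-algebra via $f$; $V_\alpha(A)$ is regarded as an affine space over $K$; and $V_\alpha(f)\colon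 V_\alpha(k)\to V_\alpha(A)$ is the map induced by $f$, that is, $f\colon k\to A$ for $\alpha$ long and $L\to A\otimes_kL$, $x\mapsto1\otimes x$, for $\alpha$ short. Moreover, $A$ is the algebraic ring attached to the restriction of $\rho$ to the split subgroup $\mathrm{Sp}_{2n}(k)=G(k)\cap\mathrm{GL}_{2n}(k)$, in the following sense: for every $\alpha\in\Phi_k$ the restriction of $\psi_\alpha$ to $A\subseteq V_\alpha(A)$ (all of $V_\alpha(A)$ if $\alpha$ is long, and $a\mapsto\psi_\alpha(a\otimes1)$ if $\alpha$ is short) is an isomorphism of varieties from $A$ onto the Zariski closure of $\rho(X_\alpha(k))$ in $\mathrm{GL}_m(K)$, where $k\subseteq L=V_\alpha(k)$ if $\alpha$ is short. -/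

import Mathlib

open scoped TensorProduct

universe u v w

namespace SpecialUnitary

/-! ### The quasi-split special unitary group `SU_{2n}(L, h)` and its root subgroups

`L/k` is a quadratic field extension and `τ` is its nontrivial automorphism. The rows and columns of
`2n × 2n` matrices are indexed by `Fin 2 × Fin n`, in the order
`(0,0), (1,0), (0,1), (1,1), …`; so `(0, i)` is the `i`-th odd index (counting from `i = 0`)
and `(1, i)` is its successor. -/

section Group

variable {k : Type u} {L : Type v} [Field k] [Field L] [Algebra k L]

/-- The matrix of the skew-hermitian form `h` of maximal Witt index: `n` diagonal blocks
`(0, -1; 1, 0)`. -/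
def formMatrix (n : ℕ) (L : Type v) [Field L] : Matrix (Fin 2 × Fin n) (Fin 2 × Fin n) L :=
  Matrix.blockDiagonal fun _ : Fin n => !![0, -1; 1, 0]

/-- The conjugate transpose `X^*` of a matrix, with respect to the automorphism `τ`. -/
def conjTr {n : ℕ} (τ : L ≃ₐ[k] L) (X : Matrix (Fin 2 × Fin n) (Fin 2 × Fin n) L) :
    Matrix (Fin 2 × Fin n) (Fin 2 × Fin n) L :=
  X.transpose.map τ

theorem conjTr_one {n : ℕ} (τ : L ≃ₐ[k] L) :
    conjTr τ (1 : Matrix (Fin 2 × Fin n) (Fin 2 × Fin n) L) = 1 := by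
  simp [conjTr]

theorem conjTr_mul {n : ℕ} (τ : L ≃ₐ[k] L) (X Y : Matrix (Fin 2 × Fin n) (Fin 2 × Fin n) L) :
    conjTr τ (X * Y) = conjTr τ Y * conjTr τ X := by
  ext i j
  simp [conjTr, Matrix.mul_apply, mul_comm]

theorem conjTr_add {n : ℕ} (τ : L ≃ₐ[k] L) (X Y : Matrix (Fin 2 × Fin n) (Fin 2 × Fin n) L) :
    conjTr τ (X + Y) = conjTr τ X + conjTr τ Y := by
  ext i j
  simp [conjTr]

theorem conjTr_single {n : ℕ} (τ : L ≃ₐ[k] L) (p q : Fin 2 × Fin n) (x : L) :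
    conjTr τ (Matrix.single p q x) = Matrix.single q p (τ x) := by
  simp [conjTr, Matrix.map_single]

/-- The group `G(k) = SU_{2n}(L, h) = {X ∈ SL_{2n}(L) | X^* H X = H}` of `k`-rational points. -/
def SU (n : ℕ) (τ : L ≃ₐ[k] L) :
    Subgroup (Matrix.SpecialLinearGroup (Fin 2 × Fin n) L) where
  carrier := {X | conjTr τ X.1 * formMatrix n L * X.1 = formMatrix n L}
  one_mem' := by simp [conjTr_one]
  mul_mem' := by
    intro X Y hX hY
    simp only [Set.mem_ofPred_eq, Matrix.SpecialLinearGroup.coe_mul, conjTr_mul] at *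
    calc _ = conjTr τ Y.1 * (conjTr τ X.1 * formMatrix n L * X.1) * Y.1 := by
          simp only [Matrix.mul_assoc]
      _ = _ := by rw [hX, hY]
  inv_mem' := by
    intro X hX
    simp only [Set.mem_ofPred_eq] at *
    have h1 : X.1 * (X⁻¹).1 = 1 := by
      rw [← Matrix.SpecialLinearGroup.coe_mul, mul_inv_cancel, Matrix.SpecialLinearGroup.coe_one]
    have h2 : conjTr τ (X⁻¹).1 * conjTr τ X.1 = 1 := by
      rw [← conjTr_mul, h1, conjTr_one]
    calc _ = conjTr τ (X⁻¹).1 * (conjTr τ X.1 * formMatrix n L * X.1) * (X⁻¹).1 := by rw [hX]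
      _ = (conjTr τ (X⁻¹).1 * conjTr τ X.1) * formMatrix n L * (X.1 * (X⁻¹).1) := by
          simp only [Matrix.mul_assoc]
      _ = _ := by rw [h1, h2, one_mul, mul_one]

/-- The long relative roots `2α_i` (`pos i`) and `-2α_i` (`neg i`) of type `C_n`. -/
inductive LongRoot (n : ℕ) : Type
  | pos (i : Fin n) : LongRoot n
  | neg (i : Fin n) : LongRoot n

/-- The short relative roots of type `C_n`, each listed once: `α_i - α_j` (`sub i j`, `i ≠ j`),
`α_i + α_j` (`add i j`, `i < j`) and `-α_i - α_j` (`negAdd i j`, `i < j`). -/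
inductive ShortRoot (n : ℕ) : Type
  | sub (i j : Fin n) (h : i ≠ j) : ShortRoot n
  | add (i j : Fin n) (h : i < j) : ShortRoot n
  | negAdd (i j : Fin n) (h : i < j) : ShortRoot n

/-- The matrix of `X_α(x)` for a long root `α` and `x ∈ V_α(k) = k`. -/
def longMatrix {n : ℕ} (L : Type v) [Field L] [Algebra k L] :
    LongRoot n → k → Matrix (Fin 2 × Fin n) (Fin 2 × Fin n) L
  | .pos i, x => 1 + Matrix.single (0, i) (1, i) (algebraMap k L x)
  | .neg i, x => 1 + Matrix.single (1, i) (0, i) (algebraMap k L x)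

/-- The matrix of `X_α(x)` for a short root `α` and `x ∈ V_α(k) = L`. -/
def shortMatrix {n : ℕ} (τ : L ≃ₐ[k] L) :
    ShortRoot n → L → Matrix (Fin 2 × Fin n) (Fin 2 × Fin n) L
  | .sub i j _, x => 1 + Matrix.single (0, i) (0, j) x - Matrix.single (1, j) (1, i) (τ x)
  | .add i j _, x => 1 + Matrix.single (0, i) (1, j) x + Matrix.single (0, j) (1, i) (τ x)
  | .negAdd i j _, x => 1 + Matrix.single (1, j) (0, i) x + Matrix.single (1, i) (0, j) (τ x)

theorem formMatrix_transpose (n : ℕ) : (formMatrix n L).transpose = -formMatrix n L := by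
  ext ⟨a, b⟩ ⟨c, d⟩
  fin_cases a <;> fin_cases c <;> by_cases h : d = b <;>
    simp [formMatrix, Matrix.blockDiagonal_apply, h, eq_comm (a := b)]

theorem formMatrix_mul_single_zero {n : ℕ} (i : Fin n) (q : Fin 2 × Fin n) (x : L) :
    formMatrix n L * Matrix.single (0, i) q x = Matrix.single (1, i) q x := by
  ext ⟨a, b⟩ ⟨c, d⟩
  fin_cases a <;> by_cases h : q = (c, d) <;> by_cases hb : b = i <;>
    simp_all [Matrix.mul_apply, formMatrix, Matrix.blockDiagonal_apply, Matrix.single_apply,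
      eq_comm]

theorem formMatrix_mul_single_one {n : ℕ} (i : Fin n) (q : Fin 2 × Fin n) (x : L) :
    formMatrix n L * Matrix.single (1, i) q x = -Matrix.single (0, i) q x := by
  ext ⟨a, b⟩ ⟨c, d⟩
  fin_cases a <;> by_cases h : q = (c, d) <;> by_cases hb : b = i <;>
    simp_all [Matrix.mul_apply, formMatrix, Matrix.blockDiagonal_apply, Matrix.single_apply,
      eq_comm]

theorem single_zero_mul_formMatrix {n : ℕ} (i : Fin n) (q : Fin 2 × Fin n) (x : L) :
    Matrix.single q (0, i) x * formMatrix n L = -Matrix.single q (1, i) x := by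
  apply Matrix.transpose_injective
  simp [Matrix.transpose_mul, Matrix.transpose_neg, formMatrix_transpose,
    Matrix.transpose_single, formMatrix_mul_single_zero]

theorem single_one_mul_formMatrix {n : ℕ} (i : Fin n) (q : Fin 2 × Fin n) (x : L) :
    Matrix.single q (1, i) x * formMatrix n L = Matrix.single q (0, i) x := by
  apply Matrix.transpose_injective
  simp [Matrix.transpose_mul, formMatrix_transpose,
    Matrix.transpose_single, formMatrix_mul_single_one]

theorem det_one_add_single_add_single {ι : Type*} [Fintype ι] [DecidableEq ι] {a b c d : ι}
    (hab : a ≠ b) (hcd : c ≠ d) (hbc : b ≠ c) (x y : L) :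
    (1 + Matrix.single a b x + Matrix.single c d y).det = 1 := by
  have : (1 + Matrix.single a b x + Matrix.single c d y : Matrix ι ι L)
      = Matrix.transvection a b x * Matrix.transvection c d y := by
    have h0 : Matrix.single a b x * Matrix.single c d y = (0 : Matrix ι ι L) :=
      Matrix.single_mul_single_of_ne (i := a) (h := hbc) ..
    simp [Matrix.transvection, mul_add, add_mul, h0, add_assoc]
  rw [this, Matrix.det_mul, Matrix.det_transvection_of_ne _ _ hab,
    Matrix.det_transvection_of_ne _ _ hcd, one_mul]

theorem longMatrix_det {n : ℕ} (α : LongRoot n) (x : k) : (longMatrix L α x).det = 1 := by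
  cases α <;> exact Matrix.det_transvection_of_ne _ _ (by simp) _

theorem shortMatrix_det {n : ℕ} (τ : L ≃ₐ[k] L) (α : ShortRoot n) (x : L) :
    (shortMatrix τ α x).det = 1 := by
  cases α with
  | sub i j h =>
    rw [shortMatrix, sub_eq_add_neg, Matrix.single_neg]
    exact det_one_add_single_add_single (by simpa using h) (by simpa using h.symm) (by simp) _ _
  | add i j h => exact det_one_add_single_add_single (by simp) (by simp) (by simp) _ _
  | negAdd i j h => exact det_one_add_single_add_single (by simp) (by simp) (by simp) _ _

theorem longMatrix_mem {n : ℕ} (τ : L ≃ₐ[k] L) (α : LongRoot n) (x : k) :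
    conjTr τ (longMatrix L α x) * formMatrix n L * longMatrix L α x = formMatrix n L := by
  cases α <;>
    simp [longMatrix, conjTr_add, conjTr_one, conjTr_single, add_mul, mul_add,
      formMatrix_mul_single_zero, formMatrix_mul_single_one, single_zero_mul_formMatrix,
      single_one_mul_formMatrix, Matrix.single_mul_single_of_ne]

/-- An automorphism of a quadratic extension is an involution. -/
theorem apply_apply [Algebra.IsQuadraticExtension k L] (τ : L ≃ₐ[k] L) (x : L) :
    τ (τ x) = x := by
  have hfin : Module.finrank k L = 2 := Algebra.IsQuadraticExtension.finrank_eq_two k L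
  have : FiniteDimensional k L := FiniteDimensional.of_finrank_pos (by omega)
  have hle : Fintype.card (L ≃ₐ[k] L) ≤ 2 := hfin ▸ AlgEquiv.card_le
  have hpos : 0 < Fintype.card (L ≃ₐ[k] L) := Fintype.card_pos
  have hpow : τ ^ Fintype.card (L ≃ₐ[k] L) = 1 := pow_card_eq_one
  have h2 : τ ^ 2 = 1 := by
    obtain h | h : Fintype.card (L ≃ₐ[k] L) = 1 ∨ Fintype.card (L ≃ₐ[k] L) = 2 := by omega
    · rw [h, pow_one] at hpow
      rw [hpow, one_pow]
    · rwa [h] at hpow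
  have := DFunLike.congr_fun h2 x
  simpa [pow_two] using this

theorem conjTr_sub {n : ℕ} (τ : L ≃ₐ[k] L) (X Y : Matrix (Fin 2 × Fin n) (Fin 2 × Fin n) L) :
    conjTr τ (X - Y) = conjTr τ X - conjTr τ Y := by
  ext i j
  simp [conjTr]

theorem shortMatrix_mem [Algebra.IsQuadraticExtension k L] {n : ℕ} (τ : L ≃ₐ[k] L)
    (α : ShortRoot n) (x : L) :
    conjTr τ (shortMatrix τ α x) * formMatrix n L * shortMatrix τ α x = formMatrix n L := by
  cases α with
  | sub i j h =>
    simp [shortMatrix, conjTr_sub, sub_mul, mul_sub, conjTr_add, conjTr_one, conjTr_single, add_mul, mul_add,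
      apply_apply, formMatrix_mul_single_zero, formMatrix_mul_single_one,
      single_zero_mul_formMatrix, single_one_mul_formMatrix, Matrix.single_mul_single_of_ne, h, h.symm]
  | add i j h =>
    simp [shortMatrix, conjTr_add, conjTr_one, conjTr_single, add_mul, mul_add,
      apply_apply, formMatrix_mul_single_zero,
      single_zero_mul_formMatrix, Matrix.single_mul_single_of_ne, h.ne, h.ne']
  | negAdd i j h =>
    simp [shortMatrix, conjTr_add, conjTr_one, conjTr_single, add_mul, mul_add,
      apply_apply, formMatrix_mul_single_one,
      single_one_mul_formMatrix, Matrix.single_mul_single_of_ne, h.ne, h.ne']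

/-- The root subgroup map `X_α : V_α(k) = k → G(k)` of a long root `α`. -/
def XLong {n : ℕ} (τ : L ≃ₐ[k] L) (α : LongRoot n) (x : k) : SU n τ :=
  ⟨⟨longMatrix L α x, longMatrix_det α x⟩, longMatrix_mem τ α x⟩

/-- The root subgroup map `X_α : V_α(k) = L → G(k)` of a short root `α`. -/
def XShort [Algebra.IsQuadraticExtension k L] {n : ℕ} (τ : L ≃ₐ[k] L) (α : ShortRoot n) (x : L) :
    SU n τ :=
  ⟨⟨shortMatrix τ α x, shortMatrix_det τ α x⟩, shortMatrix_mem τ α x⟩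

end Group

end SpecialUnitary

namespace AffineVariety

/-! ### Classical affine varieties

An affine variety over an algebraically closed field `K` is a set `X` together with its `K`-algebra
`𝒪X` of regular functions `X → K`. Here the varieties are finite-dimensional vector spaces,
the group `GL_m(K)`, and their closed subsets. -/

section

variable {K : Type w} [Field K]

/-- The regular functions on a finite-dimensional vector space `V`, viewed as an affine space:
the polynomial functions, i.e. the `K`-algebra of functions generated by the linear forms. -/
def regVec (K : Type w) [Field K] (V : Type*) [AddCommGroup V] [Module K V] :
    Subalgebra K (V → K) :=
  Algebra.adjoin K (Set.range fun l : Module.Dual K V => (l : V → K))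

/-- The regular functions on `GL_m(K)`: the `K`-algebra generated by the matrix entries
of `g` and of `g⁻¹` (equivalently, by the entries of `g` and `1 / det g`). -/
def regGL (K : Type w) [Field K] (m : ℕ) : Subalgebra K (GL (Fin m) K → K) :=
  Algebra.adjoin K
    ((Set.range fun (ij : Fin m × Fin m) (g : GL (Fin m) K) => (g : Matrix _ _ K) ij.1 ij.2) ∪
     (Set.range fun (ij : Fin m × Fin m) (g : GL (Fin m) K) =>
        ((g⁻¹ : GL (Fin m) K) : Matrix _ _ K) ij.1 ij.2))

variable {X Y : Type*}

/-- The Zariski closure of a set `S` in the variety `X`: the common zeros of all regular functions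
that vanish on `S`. -/
def zariskiClosure (𝒪X : Subalgebra K (X → K)) (S : Set X) : Set X :=
  {x | ∀ p ∈ 𝒪X, (∀ s ∈ S, p s = 0) → p x = 0}

/-- A regular map: composition with it takes regular functions to regular functions. -/
def IsRegularMap (𝒪X : Subalgebra K (X → K)) (𝒪Y : Subalgebra K (Y → K)) (φ : X → Y) : Prop :=
  ∀ p ∈ 𝒪Y, p ∘ φ ∈ 𝒪X

/-- `φ : X → Y` is an isomorphism of varieties from `X` onto the closed subset `Z` of `Y`, whose
regular functions are the restrictions of those on `Y`: it is a bijection from `X` to `Z`,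
it is regular, and every regular function on `X` is the pullback of one on `Z`. -/
structure IsIsoOnto (𝒪X : Subalgebra K (X → K)) (𝒪Y : Subalgebra K (Y → K)) (φ : X → Y)
    (Z : Set Y) : Prop where
  injective : Function.Injective φ
  range_eq : Set.range φ = Z
  regular : IsRegularMap 𝒪X 𝒪Y φ
  lift : ∀ q ∈ 𝒪X, ∃ p ∈ 𝒪Y, p ∘ φ = q

end

end AffineVariety

/-- Two algebra structures on one commutative ring commute with each other. It makes
`A ⊗[k] L` a `K`-vector space when `A` is both a `K`-algebra and a `k`-algebra. -/
instance smulCommClass_of_algebra_algebra {k : Type*} {K : Type*} {A : Type*} [CommSemiring k]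
    [CommSemiring K] [CommSemiring A] [Algebra k A] [Algebra K A] : SMulCommClass k K A where
  smul_comm a b x := by
    simp only [Algebra.smul_def, mul_left_comm]

/-! Torus conjugation makes each root element conjugate to all its powers with exponent t², t a
positive integer. The eigenvalues of its image under ρ then form a finite set mapped onto itself by
every x ↦ x^(t²), so they are all 1 (`Matrix.sub_one_pow_eq_zero_of_conj`). The images of the root
subgroups being unipotent, N_α(x) = log ρ(X_α(x)) is defined, and it is additive in x.

Everything else is linear algebra on the values N_α(x). Conjugation by ρ(c) is a linear operator on
matrices, and the commutator relations of type C_n say how it acts on the N_α. Linear combinations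
of such operators send N_α(y), for α long, to N_β(yx) for a short root β and a fixed x in L, and
return from short roots to long ones. Composing them gives, for any two long roots and any x in k, a
linear operator taking N_α(y) to N_β(xy) for all y (`exists_linear_logLong_logLong`).

For one long root α₀ these operators act on the K-span of N_{α₀}(k) as multiplications by the
elements of k. They generate a commutative finite-dimensional algebra A, with f sending x to
multiplication by x and an injective linear map e : A → M_m(K) satisfying e(f(y)) = N_{α₀}(y)
(`exists_algebra_of_additive_map`). For the other roots, transporting e gives linear maps E_α on
V_α(A) that extend N_α; short roots need a gluing over L (`exists_tensor_lift`).

Finally ψ_α = exp ∘ E_α. It is polynomial because the values of E_α are nilpotent, and it lands in H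
because an additive subgroup is Zariski-dense in its span in characteristic 0
(`zariskiClosure_range_eq_univ`). Where E_α is injective, the logarithm provides a polynomial
inverse (`isIsoOnto_expGL`). -/

namespace IsNilpotent

/-! ### Truncated logarithm and exponential of unipotent and nilpotent elements -/

open Polynomial in
/-- The polynomial `log(1 + X)` truncated at degree `N`. -/
noncomputable def logPoly (N : ℕ) : ℚ[X] := ∑ j ∈ Finset.range N, C ((-1) ^ (j + 1) / j : ℚ) * X ^ j

open Polynomial in
theorem X_dvd_logPoly (N : ℕ) : X ∣ logPoly N := by
  rw [logPoly]
  refine Finset.dvd_sum fun j _ => ?_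
  -- The term j = 0 has coefficient -1/0, which is 0 by convention, so there is no constant term.
  rcases j with _ | j
  · simp
  · exact Dvd.intro_left (C ((-1) ^ (j + 1 + 1) / ((j + 1 : ℕ) : ℚ)) * X ^ j) (by ring)

open Polynomial in
theorem one_add_X_mul_derivative_logPoly (N : ℕ) :
    (1 + X) * derivative (logPoly (N + 1)) = 1 - (-X) ^ N := by
  rw [logPoly, derivative_sum]
  have h : ∀ j : ℕ, derivative (C ((-1) ^ (j + 1 + 1) / ((j + 1 : ℕ) : ℚ)) * X ^ (j + 1)) =
      (-X : ℚ[X]) ^ j := by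
    intro j
    have hj : ((j : ℚ) + 1) ≠ 0 := by positivity
    have h1 : (C ((-1) ^ (j + 1 + 1) / ((j + 1 : ℕ) : ℚ)) * C (((j + 1 : ℕ) : ℚ)) : ℚ[X]) =
        (-1) ^ j := by
      rw [← C_mul, div_mul_cancel₀ _ (by exact_mod_cast hj)]
      simp only [map_pow, map_neg, map_one]
      ring
    rw [derivative_C_mul_X_pow, C_mul, h1, neg_pow (X : ℚ[X]), Nat.add_sub_cancel]
  rw [Finset.sum_range_succ']
  simp only [h]
  have := mul_neg_geom_sum (-X : ℚ[X]) N
  simpa [sub_neg_eq_add] using this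

open Polynomial in
/-- The truncations satisfy `exp (log (1 + X)) ≡ 1 + X` modulo `X ^ N`. -/
theorem X_pow_dvd_exp_logPoly (N : ℕ) :
    (X : ℚ[X]) ^ (N + 1) ∣
      ∑ i ∈ Finset.range (N + 1), C ((i.factorial : ℚ)⁻¹) * logPoly (N + 1) ^ i - (1 + X) := by
  set l := logPoly (N + 1) with hl
  set F : ℚ[X] := ∑ i ∈ Finset.range (N + 1), C ((i.factorial : ℚ)⁻¹) * l ^ i with hF
  have hXl : X ∣ l := X_dvd_logPoly _
  -- Differentiating the truncated exponential series drops its top term.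
  have hF' : derivative F = derivative l * (F - C ((N.factorial : ℚ)⁻¹) * l ^ N) := by
    rw [hF, Finset.sum_range_succ _ N, add_sub_cancel_right, derivative_add,
      derivative_sum, Finset.mul_sum, ← derivative_sum]
    rw [← derivative_add, ← Finset.sum_range_succ, derivative_sum, Finset.sum_range_succ']
    simp only [pow_zero, mul_one, derivative_C, add_zero]
    refine Finset.sum_congr rfl fun i _ => ?_
    rw [derivative_C_mul, derivative_pow_succ, Nat.factorial_succ]
    have : ((i : ℚ) + 1) ≠ 0 := by positivity
    have h1 : (C (((i + 1) * i.factorial : ℕ) : ℚ)⁻¹ * C ((i : ℚ) + 1) : ℚ[X]) =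
        C ((i.factorial : ℚ)⁻¹) := by
      rw [← C_mul]; push_cast; congr 1; field_simp
    rw [← h1]; push_cast; ring
  -- Both F and 1 + X solve (1 + X) y' = y modulo X^N. With equal constant terms, the recursion on
  -- coefficients makes their difference vanish through degree N.
  have hX : (X : ℚ[X]) ^ N ∣ (1 + X) * derivative (F - (1 + X)) - (F - (1 + X)) := by
    have e : (1 + X) * derivative (F - (1 + X)) - (F - (1 + X)) =
        -(-X) ^ N * (F - C ((N.factorial : ℚ)⁻¹) * l ^ N) - C ((N.factorial : ℚ)⁻¹) * l ^ N := by
      have h2 := one_add_X_mul_derivative_logPoly N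
      rw [derivative_sub, hF']
      simp only [derivative_add, derivative_one, derivative_X]
      linear_combination (F - C ((N.factorial : ℚ)⁻¹) * l ^ N) * h2
    rw [e]
    refine dvd_sub (Dvd.dvd.mul_right ?_ _) (Dvd.dvd.mul_left (pow_dvd_pow_of_dvd hXl N) _)
    rw [dvd_neg, neg_pow]
    exact Dvd.intro_left _ rfl
  set G := F - (1 + X) with hG
  rw [X_pow_dvd_iff] at hX ⊢
  have h0 : G.coeff 0 = 0 := by
    have : l.coeff 0 = 0 := X_dvd_iff.1 hXl
    rw [coeff_zero_eq_eval_zero] at this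
    rw [hG, hF, coeff_zero_eq_eval_zero]
    simp only [eval_sub, eval_finsetSum, eval_mul, eval_C, eval_pow, eval_add, eval_one, eval_X]
    rw [this, Finset.sum_range_succ']
    simp
  intro d
  induction d with
  | zero => exact fun _ => h0
  | succ d ih =>
    intro hd
    have h1 := hX d (by omega)
    have h2 := ih (by omega)
    rw [coeff_sub, h2, add_mul, one_mul, coeff_add, coeff_derivative, sub_zero] at h1
    have h3 : (X * derivative G).coeff d = 0 := by
      rcases d with _ | d
      · simp
      · rw [coeff_X_mul, coeff_derivative, h2, zero_mul]
    rw [h3, add_zero] at h1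
    exact (mul_eq_zero.1 h1).resolve_right (by positivity)

variable {R : Type*} [Ring R] [Algebra ℚ R]

/-- The logarithm of a unipotent element `u` with `(u - 1) ^ N = 0`. -/
noncomputable def logTrunc (N : ℕ) (u : R) : R :=
  ∑ j ∈ Finset.range N, ((-1) ^ (j + 1) / j : ℚ) • (u - 1) ^ j

theorem logTrunc_eq_aeval (N : ℕ) (u : R) : logTrunc N u = Polynomial.aeval (u - 1) (logPoly N) := by
  simp [logTrunc, logPoly, Algebra.smul_def]

theorem isNilpotent_logTrunc {N : ℕ} {u : R} (hu : (u - 1) ^ N = 0) :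
    (logTrunc N u) ^ N = 0 := by
  obtain ⟨q, hq⟩ := X_dvd_logPoly N
  rw [logTrunc_eq_aeval, hq, ← map_pow, mul_pow, map_mul, map_pow, Polynomial.aeval_X, hu, zero_mul]

theorem exp_logTrunc {N : ℕ} {u : R} (hu : (u - 1) ^ N = 0) : exp (logTrunc N u) = u := by
  rw [exp_eq_sum (isNilpotent_logTrunc hu)]
  rcases N with _ | N
  · have := subsingleton_of_zero_eq_one (by simpa using hu.symm : (0 : R) = 1)
    exact Subsingleton.elim _ _
  obtain ⟨q, hq⟩ := X_pow_dvd_exp_logPoly N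
  have := congrArg (Polynomial.aeval (u - 1)) hq
  rw [map_mul, map_pow, Polynomial.aeval_X, hu, zero_mul, map_sub, map_sum, sub_eq_zero] at this
  simpa [logTrunc_eq_aeval, Algebra.smul_def] using this

/-- For d = a - b commutation gives exp d = 1, while exp d - 1 = d (1 + s d), where 1 + s d is a
unit because s d is nilpotent. -/
theorem exp_injective_of_commute {a b : R} (hab : Commute a b) (ha : IsNilpotent a)
    (hb : IsNilpotent b) (h : exp a = exp b) : a = b := by
  have hd : IsNilpotent (a - b) := hab.isNilpotent_sub ha hb
  have h1 : exp (a - b) = 1 := by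
    rw [sub_eq_add_neg, exp_add_of_commute hab.neg_right ha hb.neg, h, exp_mul_exp_neg_self hb]
  obtain ⟨N, hN⟩ := hd
  -- The exponent N + 2 allows the terms of degrees 0 and 1 to be split off the series.
  have hN2 : (a - b) ^ (N + 2) = 0 := by rw [pow_add, hN, zero_mul]
  rw [exp_eq_sum hN2, Finset.sum_range_succ', Finset.sum_range_succ'] at h1
  simp only [pow_zero, zero_add, pow_one, Nat.factorial_zero, Nat.factorial_one, Nat.cast_one,
    inv_one, one_smul, add_eq_right] at h1
  set s : R := ∑ i ∈ Finset.range N, (((i + 1 + 1).factorial : ℚ)⁻¹) • (a - b) ^ i with hs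
  have h2 : (a - b) * (1 + s * (a - b)) = 0 := by
    rw [mul_add, mul_one, ← mul_assoc, hs, Finset.mul_sum, Finset.sum_mul, add_comm, ← h1]
    congr 1
    refine Finset.sum_congr rfl fun i _ => ?_
    rw [mul_smul_comm, smul_mul_assoc, ← _root_.pow_succ', ← _root_.pow_succ]
  have hcs : Commute s (a - b) := by
    refine Commute.sum_left _ _ _ fun i _ => ?_
    exact ((Commute.refl (a - b)).pow_left i).smul_left _
  have hu : IsUnit (1 + s * (a - b)) :=
    (hcs.isNilpotent_mul_left ⟨N, hN⟩).isUnit_one_add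
  rw [hu.mul_left_eq_zero, sub_eq_zero] at h2
  exact h2

theorem exp_sub_one_pow_eq_zero {N : ℕ} {a : R} (ha : a ^ N = 0) : (exp a - 1) ^ N = 0 := by
  rcases N with _ | N
  · simpa using ha
  have : exp a - 1 = a * ∑ i ∈ Finset.range N, (((i + 1).factorial : ℚ)⁻¹) • a ^ i := by
    rw [exp_eq_sum ha, Finset.sum_range_succ', Finset.mul_sum]
    simp [_root_.pow_succ']
  rw [this, Commute.mul_pow, ha, zero_mul]
  exact Commute.sum_right _ _ _ fun i _ => ((Commute.refl a).pow_right i).smul_right _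

/-- Both sides are commuting nilpotents with the same exponential, so no second power series
identity is needed. -/
theorem logTrunc_exp {N : ℕ} {a : R} (ha : a ^ N = 0) : logTrunc N (exp a) = a := by
  have hc : Commute a (exp a - 1) := by
    rw [exp]
    refine (Commute.sum_right _ _ _ fun i _ => ?_).sub_right (Commute.one_right a)
    exact ((Commute.refl a).pow_right i).smul_right _
  have hN := exp_sub_one_pow_eq_zero ha
  refine exp_injective_of_commute ?_ ⟨N, isNilpotent_logTrunc hN⟩ ⟨N, ha⟩ (exp_logTrunc hN)
  rw [logTrunc]
  exact Commute.sum_left _ _ _ fun i _ => (hc.symm.pow_left i).smul_left _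

end IsNilpotent

/-! ### Unipotence from conjugacy to powers -/

namespace Matrix

variable {K : Type w} [Field K] {m : ℕ}

/-- Over a field a nilpotent `m × m` matrix has vanishing `m`-th power. -/
theorem pow_eq_zero_of_isNilpotent {N : Matrix (Fin m) (Fin m) K} (hN : IsNilpotent N) :
    N ^ m = 0 := by
  have h := Matrix.isNilpotent_charpoly_sub_pow_of_isNilpotent hN
  rw [isNilpotent_iff_eq_zero, sub_eq_zero, Fintype.card_fin] at h
  have := Matrix.aeval_self_charpoly N
  rwa [h, map_pow, Polynomial.aeval_X] at this

/-- An invertible matrix `g` that is conjugate to all its powers `g ^ (t ^ 2)` is unipotent. -/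
theorem sub_one_pow_eq_zero_of_conj [IsAlgClosed K] (g : GL (Fin m) K)
    (h : ∀ t : ℕ, 0 < t → ∃ c : GL (Fin m) K, c * g * c⁻¹ = g ^ (t ^ 2)) :
    ((g : Matrix (Fin m) (Fin m) K) - 1) ^ m = 0 := by
  obtain ⟨M, hM⟩ : ∃ M : Matrix (Fin m) (Fin m) K, M = g.val := ⟨_, rfl⟩
  rw [← hM]
  have hspec : ∀ t : ℕ, 0 < t → (fun x : K => x ^ (t ^ 2)) '' spectrum K M = spectrum K M := by
    intro t ht
    obtain ⟨c, hc⟩ := h t ht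
    rw [← spectrum.map_pow_of_pos M (by positivity), hM, ← Units.val_pow_eq_pow_val, ← hc,
      Units.val_mul, Units.val_mul, spectrum.units_conjugate]
  have hfin : (spectrum K M).Finite := by
    classical
    refine (M.charpoly.roots.toFinset.finite_toSet).subset fun x hx => ?_
    simpa [M.charpoly_monic.ne_zero] using (mem_spectrum_iff_isRoot_charpoly).1 hx
  -- With t = 2, the map x ↦ x⁴ is a surjection of a finite set onto itself, hence a permutation. So
  -- every x is periodic, x^(4^j) = x, and x ≠ 0 by invertibility.
  have hroot : ∀ x ∈ spectrum K M, ∃ N : ℕ, 0 < N ∧ x ^ N = 1 := by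
    intro x hx
    have hx0 : x ≠ 0 := by
      rintro rfl
      exact (spectrum.zero_notMem_iff K).2 (hM ▸ g.isUnit) hx
    have h2 := hspec 2 (by norm_num)
    let F : spectrum K M → spectrum K M := fun y => ⟨(y : K) ^ (2 ^ 2), h2.subset ⟨y, y.2, rfl⟩⟩
    have : Finite (spectrum K M) := hfin
    have hF : Function.Surjective F := by
      rintro ⟨y, hy⟩
      obtain ⟨z, hz, rfl⟩ := h2.superset hy
      exact ⟨⟨z, hz⟩, rfl⟩
    have hFi := Finite.injective_iff_surjective.2 hF
    have hiter : ∀ j (y : spectrum K M), ((F^[j] y : spectrum K M) : K) = (y : K) ^ (4 ^ j) := by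
      intro j
      induction j with
      | zero => simp
      | succ j ih => intro y; rw [Function.iterate_succ_apply, ih, pow_succ' 4, pow_mul]; simp [F]
    obtain ⟨j, hj, hjx⟩ := (hFi.mem_periodicPts ⟨x, hx⟩ :)
    have h1 : x ^ (4 ^ j) = x := by
      rw [← hiter j ⟨x, hx⟩, hjx.eq]
    have h4 : 1 < 4 ^ j := Nat.one_lt_pow hj.ne' (by norm_num)
    refine ⟨4 ^ j - 1, by omega, mul_right_cancel₀ hx0 ?_⟩
    rw [← pow_succ, Nat.sub_add_cancel h4.le, h1, one_mul]
  have hroot' : ∃ N : ℕ, 0 < N ∧ ∀ x ∈ spectrum K M, x ^ N = 1 := by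
    choose! N hN0 hN using hroot
    refine ⟨∏ x ∈ hfin.toFinset, N x, Finset.prod_pos fun x hx => hN0 x (by simpa using hx), ?_⟩
    intro x hx
    obtain ⟨c, hc⟩ := Finset.dvd_prod_of_mem N (hfin.mem_toFinset.2 hx)
    rw [hc, pow_mul, hN x hx, one_pow]
  obtain ⟨N, hN0, hN⟩ := hroot'
  -- Taking t = N, a common order of the eigenvalues, each eigenvalue is y^(N²) = 1 for some
  -- eigenvalue y.
  have hone : ∀ x ∈ spectrum K M, x = 1 := by
    intro x hx
    obtain ⟨y, hy, rfl⟩ := (hspec N hN0).superset hx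
    simp [pow_two N, pow_mul, hN y hy]
  have hchar : M.charpoly = (Polynomial.X - Polynomial.C 1) ^ m := by
    have h1 := (IsAlgClosed.splits M.charpoly).eq_prod_roots_of_monic M.charpoly_monic
    have h2 : M.charpoly.roots = Multiset.replicate M.charpoly.roots.card 1 := by
      refine Multiset.eq_replicate_card.2 fun x hx => hone x ?_
      rw [mem_spectrum_iff_isRoot_charpoly]
      exact Polynomial.isRoot_of_mem_roots hx
    rw [h2] at h1
    have h3 := (IsAlgClosed.splits M.charpoly).natDegree_eq_card_roots
    rw [charpoly_natDegree_eq_dim, Fintype.card_fin] at h3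
    rw [h1, ← h3]
    simp
  have := Matrix.aeval_self_charpoly M
  rw [hchar] at this
  simpa using this

end Matrix

namespace AffineVariety

/-! ### Zariski density of additive subgroups -/

section Dense

variable {K : Type w} [Field K] {V : Type*} [AddCommGroup V] [Module K V]

theorem regVec_comp_add_right {p : V → K} (hp : p ∈ regVec K V) (s : V) :
    (fun v => p (v + s)) ∈ regVec K V := by
  rw [regVec] at hp ⊢
  induction hp using Algebra.adjoin_induction with
  | mem p hp =>
    obtain ⟨l, rfl⟩ := hp
    have : (fun v => l (v + s)) = (l : V → K) + algebraMap K (V → K) (l s) := by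
      ext v; simp
    rw [this]
    exact add_mem (Algebra.subset_adjoin ⟨l, rfl⟩) (Subalgebra.algebraMap_mem _ _)
  | algebraMap c => exact Subalgebra.algebraMap_mem _ c
  | add p q _ _ h1 h2 => exact add_mem h1 h2
  | mul p q _ _ h1 h2 => exact mul_mem h1 h2

theorem exists_polynomial_of_mem_regVec {p : V → K} (hp : p ∈ regVec K V) (v w : V) :
    ∃ P : Polynomial K, ∀ t : K, p (v + t • w) = P.eval t := by
  rw [regVec] at hp
  induction hp using Algebra.adjoin_induction with
  | mem p hp =>
    obtain ⟨l, rfl⟩ := hp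
    exact ⟨.C (l v) + .X * .C (l w), fun t => by simp; ring⟩
  | algebraMap c => exact ⟨.C c, fun t => by simp⟩
  | add p q _ _ h1 h2 =>
    obtain ⟨P, hP⟩ := h1
    obtain ⟨Q, hQ⟩ := h2
    exact ⟨P + Q, fun t => by simp [hP, hQ]⟩
  | mul p q _ _ h1 h2 =>
    obtain ⟨P, hP⟩ := h1
    obtain ⟨Q, hQ⟩ := h2
    exact ⟨P * Q, fun t => by simp [hP, hQ]⟩

/-- In characteristic zero an additive subgroup is Zariski-dense in its linear span. -/
theorem zariskiClosure_range_eq_univ [CharZero K] {B : Type*} [AddCommGroup B] (ι : B →+ V)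
    (hι : Submodule.span K (Set.range ι) = ⊤) :
    zariskiClosure (regVec K V) (Set.range ι) = Set.univ := by
  -- It suffices that the closure is stable under translation by the span, since it contains 0.
  suffices h : ∀ v ∈ Submodule.span K (Set.range ι), ∀ z ∈
      zariskiClosure (regVec K V) (Set.range ι), z + v ∈ zariskiClosure (regVec K V)
        (Set.range ι) by
    refine Set.eq_univ_of_forall fun v => ?_
    simpa using h v (hι ▸ Submodule.mem_top) 0 fun p _ h => h 0 ⟨0, map_zero ι⟩
  intro v hv
  induction hv using Submodule.closure_induction with
  | zero => simp
  | add x y _ _ hx hy => exact fun z hz => add_assoc z x y ▸ hy _ (hx z hz)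
  | smul_mem r x hx =>
    obtain ⟨b, rfl⟩ := hx
    intro z hz p hp hpι
    obtain ⟨P, hP⟩ := exists_polynomial_of_mem_regVec hp z (ι b)
    -- The translate of p by n ι(b) still vanishes on the subgroup, hence at z. So p restricted to
    -- the line through z in direction ι(b) has infinitely many zeros.
    have hroot : ∀ n : ℕ, P.eval (n : K) = 0 := fun n => by
      rw [← hP]
      refine hz _ (regVec_comp_add_right hp ((n : K) • ι b)) ?_
      rintro _ ⟨c, rfl⟩
      refine hpι _ ⟨c + n • b, ?_⟩
      simp [Nat.cast_smul_eq_nsmul]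
    have hP0 : P = 0 := Polynomial.eq_zero_of_infinite_isRoot P
      (Set.infinite_of_injective_forall_mem (f := fun n : ℕ => (n : K)) Nat.cast_injective hroot)
    rw [hP, hP0, Polynomial.eval_zero]

end Dense

/-! ### Exponential parametrisation of closed unipotent subsets -/

section Exp

variable {K : Type w} [Field K] {m : ℕ}

theorem matrix_pow_entry_mem {X : Type*} (𝒪X : Subalgebra K (X → K))
    {F : X → Matrix (Fin m) (Fin m) K} (hF : ∀ i j, (fun x => F x i j) ∈ 𝒪X) (d : ℕ) (i j : Fin m) :
    (fun x => (F x ^ d) i j) ∈ 𝒪X := by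
  induction d generalizing i j with
  | zero =>
    simp only [pow_zero]
    exact 𝒪X.algebraMap_mem ((1 : Matrix (Fin m) (Fin m) K) i j)
  | succ d ih =>
    have : (fun x => (F x ^ (d + 1)) i j) =
        ∑ l, (fun x => (F x ^ d) i l) * (fun x => F x l j) := by
      ext x
      simp [pow_succ, Matrix.mul_apply]
    rw [this]
    exact sum_mem fun l _ => mul_mem (ih i l) (hF l j)

theorem matrix_sum_pow_entry_mem [CharZero K] {X : Type*} (𝒪X : Subalgebra K (X → K))
    {F : X → Matrix (Fin m) (Fin m) K} (hF : ∀ i j, (fun x => F x i j) ∈ 𝒪X)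
    (N : ℕ) (c : ℕ → ℚ) (i j : Fin m) :
    (fun x => (∑ d ∈ Finset.range N, c d • F x ^ d) i j) ∈ 𝒪X := by
  have : (fun x => (∑ d ∈ Finset.range N, c d • F x ^ d) i j) =
      ∑ d ∈ Finset.range N, (c d : K) • (fun x => (F x ^ d) i j) := by
    ext x
    simp [Matrix.sum_apply, Rat.smul_def]
  rw [this]
  exact sum_mem fun d _ => 𝒪X.smul_mem (matrix_pow_entry_mem 𝒪X hF d i j) _

theorem linear_comp_matrix_mem {X : Type*} (𝒪X : Subalgebra K (X → K))
    {F : X → Matrix (Fin m) (Fin m) K} (hF : ∀ i j, (fun x => F x i j) ∈ 𝒪X)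
    (l : Matrix (Fin m) (Fin m) K →ₗ[K] K) : (fun x => l (F x)) ∈ 𝒪X := by
  have : (fun x => l (F x)) = ∑ i, ∑ j, l (Matrix.single i j 1) • (fun x => F x i j) := by
    ext x
    conv_lhs => rw [Matrix.matrix_eq_sum_single (F x)]
    simp only [map_sum, Finset.sum_apply, Pi.smul_apply, smul_eq_mul]
    refine Finset.sum_congr rfl fun i _ => Finset.sum_congr rfl fun j _ => ?_
    rw [mul_comm, ← smul_eq_mul, ← map_smul, Matrix.smul_single, smul_eq_mul, mul_one]
  rw [this]
  exact sum_mem fun i _ => sum_mem fun j _ => 𝒪X.smul_mem (hF i j) _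

variable [CharZero K]

/-- The exponential of a nilpotent matrix, as an invertible matrix. -/
noncomputable def expGL (a : Matrix (Fin m) (Fin m) K) (ha : IsNilpotent a) : GL (Fin m) K :=
  ⟨IsNilpotent.exp a, IsNilpotent.exp (-a), IsNilpotent.exp_mul_exp_neg_self ha,
    IsNilpotent.exp_neg_mul_exp_self ha⟩

variable {V : Type*} [AddCommGroup V] [Module K V] (E : V →ₗ[K] Matrix (Fin m) (Fin m) K)
  (hE : ∀ v, IsNilpotent (E v))

include hE in
theorem exp_entry_mem_regVec (i j : Fin m) :
    (fun v => IsNilpotent.exp (E v) i j) ∈ regVec K V := by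
  have h : ∀ v, IsNilpotent.exp (E v) =
      ∑ d ∈ Finset.range m, (d.factorial : ℚ)⁻¹ • E v ^ d := fun v =>
    IsNilpotent.exp_eq_sum (Matrix.pow_eq_zero_of_isNilpotent (hE v))
  simp only [h]
  refine matrix_sum_pow_entry_mem _ (fun i j => ?_) m _ i j
  exact Algebra.subset_adjoin ⟨Matrix.entryLinearMap K K i j ∘ₗ E, rfl⟩

theorem isRegularMap_expGL :
    IsRegularMap (regVec K V) (regGL K m) fun v => expGL (E v) (hE v) := by
  intro p hp
  rw [regGL] at hp
  induction hp using Algebra.adjoin_induction with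
  | mem p hp =>
    obtain ⟨⟨i, j⟩, rfl⟩ | ⟨⟨i, j⟩, rfl⟩ := hp
    · exact exp_entry_mem_regVec E hE i j
    · exact exp_entry_mem_regVec (-E) (fun v => by simpa using (hE v).neg) i j
  | algebraMap c => exact Subalgebra.algebraMap_mem _ c
  | add p q _ _ h1 h2 => exact add_mem h1 h2
  | mul p q _ _ h1 h2 => exact mul_mem h1 h2

variable {B : Type*} [AddCommGroup B] (ι : B →+ V) (hι : Submodule.span K (Set.range ι) = ⊤)
  (g : B → GL (Fin m) K) (hg : ∀ b, expGL (E (ι b)) (hE (ι b)) = g b)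

include hι hg in
theorem expGL_mem_zariskiClosure {S : Set (GL (Fin m) K)} (hS : Set.range g ⊆ S) (v : V) :
    expGL (E v) (hE v) ∈ zariskiClosure (regGL K m) S := by
  intro p hp hpg
  have hv : v ∈ zariskiClosure (regVec K V) (Set.range ι) := by
    rw [zariskiClosure_range_eq_univ ι hι]; trivial
  refine hv _ (isRegularMap_expGL E hE p hp) ?_
  rintro _ ⟨b, rfl⟩
  exact (congrArg p (hg b)).trans (hpg _ (hS ⟨b, rfl⟩))

theorem logTrunc_entry_mem_regGL (i j : Fin m) :
    (fun x : GL (Fin m) K => IsNilpotent.logTrunc m x.val i j) ∈ regGL K m := by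
  refine matrix_sum_pow_entry_mem _ (fun i j => ?_) m _ i j
  exact sub_mem (Algebra.subset_adjoin (.inl ⟨(i, j), rfl⟩))
    (Subalgebra.algebraMap_mem _ ((1 : Matrix (Fin m) (Fin m) K) i j))

include hι hg in
/-- An injective linear map into the nilpotent matrices, followed by the exponential, is an
isomorphism onto the Zariski closure of the image of any additive subgroup spanning its source. -/
theorem isIsoOnto_expGL (hinj : Function.Injective E) :
    IsIsoOnto (regVec K V) (regGL K m) (fun v => expGL (E v) (hE v))
      (zariskiClosure (regGL K m) (Set.range g)) := by
  have hlog : ∀ v, IsNilpotent.logTrunc m (expGL (E v) (hE v)).val = E v := fun v =>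
    IsNilpotent.logTrunc_exp (Matrix.pow_eq_zero_of_isNilpotent (hE v))
  refine ⟨fun v w hvw => hinj ?_, ?_, isRegularMap_expGL E hE, ?_⟩
  · rw [← hlog v, ← hlog w]
    exact congrArg (fun x : GL (Fin m) K => IsNilpotent.logTrunc m x.val) hvw
  · refine Set.Subset.antisymm ?_ ?_
    · rintro _ ⟨v, rfl⟩
      exact expGL_mem_zariskiClosure E hE ι hι g hg subset_rfl v
    · intro x hx
      -- Unipotence is a closed condition that holds on the image of g.
      have hunip : (x.val - 1) ^ m = 0 := by
        ext i j
        refine hx (fun x => ((x.val - 1) ^ m) i j) (matrix_pow_entry_mem _ (fun i j => ?_) m i j) ?_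
        · exact sub_mem (Algebra.subset_adjoin (.inl ⟨(i, j), rfl⟩))
            (Subalgebra.algebraMap_mem _ ((1 : Matrix (Fin m) (Fin m) K) i j))
        · rintro _ ⟨b, rfl⟩
          rw [← hg b]
          exact congrArg (fun M : Matrix (Fin m) (Fin m) K => M i j)
            (IsNilpotent.exp_sub_one_pow_eq_zero
              (Matrix.pow_eq_zero_of_isNilpotent (hE (ι b))))
      -- A linear form vanishing on the range of E, composed with the polynomial map log, is a
      -- regular function vanishing on the image of g, hence at x.
      have hrange : IsNilpotent.logTrunc m x.val ∈ LinearMap.range E := by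
        by_contra hnot
        obtain ⟨l, hl, hle⟩ := Submodule.exists_le_ker_of_notMem hnot
        refine hl (hx _ (linear_comp_matrix_mem _ logTrunc_entry_mem_regGL l) ?_)
        rintro _ ⟨b, rfl⟩
        rw [← hg b, hlog]
        exact hle ⟨_, rfl⟩
      obtain ⟨v, hv⟩ := hrange
      refine ⟨v, Units.ext ?_⟩
      change IsNilpotent.exp (E v) = x.val
      rw [hv, IsNilpotent.exp_logTrunc hunip]
  · intro q hq
    rw [regVec] at hq
    induction hq using Algebra.adjoin_induction with
    | mem q hq =>
      obtain ⟨l, rfl⟩ := hq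
      -- The linear form l is the pullback of l ∘ r ∘ log, with r a linear left inverse of E.
      obtain ⟨r, hr⟩ := E.exists_leftInverse_of_injective (LinearMap.ker_eq_bot.2 hinj)
      refine ⟨_, linear_comp_matrix_mem _ logTrunc_entry_mem_regGL (l ∘ₗ r), ?_⟩
      ext v
      simp only [Function.comp_apply, hlog, LinearMap.comp_apply]
      exact congrArg l (LinearMap.congr_fun hr v)
    | algebraMap c => exact ⟨algebraMap K _ c, Subalgebra.algebraMap_mem _ c, rfl⟩
    | add p q _ _ h1 h2 =>
      obtain ⟨P, hP, rfl⟩ := h1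
      obtain ⟨Q, hQ, rfl⟩ := h2
      exact ⟨P + Q, add_mem hP hQ, rfl⟩
    | mul p q _ _ h1 h2 =>
      obtain ⟨P, hP, rfl⟩ := h1
      obtain ⟨Q, hQ, rfl⟩ := h2
      exact ⟨P * Q, mul_mem hP hQ, rfl⟩

end Exp
end AffineVariety

/-! ### The algebra A and linear maps on its scalar extension -/

namespace AffineVariety

variable {K : Type w} [Field K]

/-- If every relation `∑ cᵢ N(xᵢ) = 0` between the values of an additive map `N : k → M` implies
`∑ cᵢ N(x xᵢ) = 0`, then the span of the image of `N` carries a ring structure that makes `N`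
a ring homomorphism. -/
theorem exists_algebra_of_additive_map {k : Type u} [CommRing k] {M : Type w} [AddCommGroup M]
    [Module K M] [Module.Finite K M] (N : k →+ M)
    (hmul : ∀ x : k, ∃ T : M →ₗ[K] M, ∀ y, T (N y) = N (x * y)) :
    ∃ (A : Type w) (_ : CommRing A) (_ : Algebra K A) (f : k →+* A) (e : A →ₗ[K] M),
      Module.Finite K A ∧ Submodule.span K (Set.range f) = ⊤ ∧ Function.Injective e ∧
      ∀ y, e (f y) = N y := by
  choose T hT using hmul
  let W := Submodule.span K (Set.range N)
  let N' : k → W := fun y => ⟨N y, Submodule.subset_span ⟨y, rfl⟩⟩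
  have hTW : ∀ x, ∀ v ∈ W, T x v ∈ W := by
    intro x v hv
    have : W ≤ W.comap (T x) := by
      refine Submodule.span_le.2 ?_
      rintro _ ⟨y, rfl⟩
      exact Submodule.subset_span ⟨x * y, (hT x y).symm⟩
    exact this hv
  have hext : ∀ φ ψ : Module.End K W, (∀ y, φ (N' y) = ψ (N' y)) → φ = ψ := by
    intro φ ψ h
    refine LinearMap.ext_on (Submodule.span_span_coe_preimage (s := Set.range N)) ?_
    rintro ⟨_, hv⟩ ⟨y, rfl⟩
    exact h y
  let D : k → Module.End K W := fun x => (T x).restrict (hTW x)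
  have hD : ∀ x y, D x (N' y) = N' (x * y) := fun x y => Subtype.ext (hT x y)
  have hadd : ∀ x y, N' (x + y) = N' x + N' y := fun x y => Subtype.ext (map_add N x y)
  let F : k →+* Module.End K W :=
    { toFun := D
      map_one' := hext _ _ fun y => by rw [hD, one_mul]; rfl
      map_mul' := fun a b => hext _ _ fun y => by
        rw [Module.End.mul_apply, hD, hD, hD, mul_assoc]
      map_zero' := hext _ _ fun y => by
        rw [hD, zero_mul]; exact Subtype.ext (map_zero N)
      map_add' := fun a b => hext _ _ fun y => by
        rw [LinearMap.add_apply, hD, hD, hD, add_mul, hadd] }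
  -- Realising the ring by operators on W, not on W itself, makes associativity automatic;
  -- commutativity comes from the generators.
  let S := Algebra.adjoin K (Set.range F)
  have hcomm : ∀ a ∈ Set.range F, ∀ b ∈ Set.range F, a * b = b * a := by
    rintro _ ⟨a, rfl⟩ _ ⟨b, rfl⟩
    rw [← map_mul, mul_comm, map_mul]
  have hS : ∀ a b : S, a * b = b * a := by
    have := Algebra.isMulCommutative_adjoin K hcomm
    exact fun a b => mul_comm' a b
  let iS : CommRing S := { (inferInstance : Ring S) with mul_comm := hS }
  let f : k →+* S := F.codRestrict S fun x => Algebra.subset_adjoin ⟨x, rfl⟩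
  let e : S →ₗ[K] M := W.subtype ∘ₗ (LinearMap.applyₗ (N' 1)) ∘ₗ S.val.toLinearMap
  have hef : ∀ y, e (f y) = N y := fun y => by
    change ((D y (N' 1) : W) : M) = N y
    rw [hD, mul_one]
  have hspan : Submodule.span K (Set.range f) = ⊤ := by
    have h1 : Subalgebra.toSubmodule S = Submodule.span K (Set.range F) := by
      have := Algebra.adjoin_eq_span K (Set.range F)
      rwa [show (Submonoid.closure (Set.range F) : Set (Module.End K W)) = Set.range F from
        congrArg _ (Submonoid.closure_eq (MonoidHom.mrange (F : k →* Module.End K W)))] at this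
    rw [eq_top_iff]
    rintro ⟨φ, hφ⟩ -
    have h2 : φ ∈ Submodule.span K (Set.range F) := h1 ▸ hφ
    have h3 : (Submodule.span K (Set.range f)).map S.val.toLinearMap =
        Submodule.span K (Set.range F) := by
      rw [Submodule.map_span, ← Set.range_comp]
      rfl
    rw [← h3] at h2
    obtain ⟨ψ, hψ, rfl⟩ := h2
    exact hψ
  refine ⟨S, iS, inferInstance, f, e, ?_, hspan, ?_, hef⟩
  · exact Module.Finite.of_injective S.val.toLinearMap Subtype.val_injective
  · intro φ ψ h
    have h0 : (φ : Module.End K W) (N' 1) = (ψ : Module.End K W) (N' 1) := Subtype.ext h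
    refine Subtype.ext (hext _ _ fun y => ?_)
    have h1 : N' y = (f y : Module.End K W) (N' 1) := ((congrArg N' (mul_one y)).symm.trans (hD y 1).symm :)
    -- Since S is commutative and N'(1) is a cyclic vector, an operator in S is determined by its
    -- value at N'(1).
    have hc : ∀ χ : S, (χ : Module.End K W) (N' y) =
        (f y : Module.End K W) ((χ : Module.End K W) (N' 1)) := fun χ => by
      rw [h1, ← Module.End.mul_apply, ← Module.End.mul_apply]
      exact congrArg (fun a : S => (a : Module.End K W) (N' 1)) (hS χ (f y))
    rw [hc, hc, h0]

section Tensor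

variable {k : Type u} {L : Type v} [Field k] [Field L] [Algebra k L]
  {A : Type w} [CommRing A] [Algebra K A] [Algebra k A]
  (hA : Submodule.span K (Set.range (algebraMap k A)) = ⊤)

-- A is spanned over K by the image of k, and f(y) ⊗ x = 1 ⊗ yx.
include hA in
theorem span_range_one_tmul :
    Submodule.span K (Set.range fun x : L => (1 : A) ⊗ₜ[k] x) = ⊤ := by
  refine Submodule.eq_top_iff'.2 fun v => ?_
  induction v using TensorProduct.induction_on with
  | zero => exact zero_mem _
  | add v w hv hw => exact add_mem hv hw
  | tmul a x =>
    have ha : a ∈ Submodule.span K (Set.range (algebraMap k A)) := hA ▸ Submodule.mem_top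
    induction ha using Submodule.span_induction with
    | zero => rw [TensorProduct.zero_tmul]; exact zero_mem _
    | add a b _ _ ha hb => rw [TensorProduct.add_tmul]; exact add_mem ha hb
    | smul c a _ ha =>
      rw [← TensorProduct.smul_tmul']; exact Submodule.smul_mem _ _ ha
    | mem a ha =>
      obtain ⟨y, rfl⟩ := ha
      rw [Algebra.algebraMap_eq_smul_one, TensorProduct.smul_tmul]
      exact Submodule.subset_span ⟨_, rfl⟩

-- Each linear map e_x is unique because the image of k spans A. Uniqueness forces x ↦ e_x to be
-- additive and (a, x) ↦ e_x(a) to be k-balanced, so these maps glue on the tensor product.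
include hA in
theorem exists_tensor_lift {M : Type*} [AddCommGroup M] [Module K M] (N : L →+ M)
    (h : ∀ x : L, ∃ e : A →ₗ[K] M, ∀ y : k, e (algebraMap k A y) = N (y • x)) :
    ∃ E : A ⊗[k] L →ₗ[K] M, ∀ (y : k) (x : L), E (algebraMap k A y ⊗ₜ x) = N (y • x) := by
  choose e he using h
  have hext : ∀ φ ψ : A →ₗ[K] M,
      (∀ y, φ (algebraMap k A y) = ψ (algebraMap k A y)) → φ = ψ := by
    intro φ ψ h
    refine LinearMap.ext_on hA ?_
    rintro _ ⟨y, rfl⟩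
    exact h y
  have hadd : ∀ x y, e (x + y) = e x + e y := fun x y =>
    hext _ _ fun z => by rw [LinearMap.add_apply, he, he, he, smul_add, map_add]
  have hzero : e 0 = 0 := by simpa using hadd 0 0
  let g : A →+ L →+ M := AddMonoidHom.flip
    { toFun := fun x => (e x).toAddMonoidHom
      map_zero' := by rw [hzero]; rfl
      map_add' := fun x y => by rw [hadd]; rfl }
  have hg : ∀ a x, g a x = e x a := fun a x => rfl
  have hbal : ∀ (r : k) (a : A) (x : L), g (r • a) x = g a (r • x) := by
    intro r a x
    rw [hg, hg]
    have : e x ∘ₗ LinearMap.mulLeft K (algebraMap k A r) = e (r • x) := hext _ _ fun y => by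
      rw [LinearMap.comp_apply, LinearMap.mulLeft_apply, ← map_mul, he, he, smul_smul, mul_comm]
    rw [← this, Algebra.smul_def]
    rfl
  let E := TensorProduct.liftAddHom g hbal
  refine ⟨{ E with map_smul' := fun c v => ?_ }, fun y x => he x y⟩
  change E (c • v) = c • E v
  induction v using TensorProduct.induction_on with
  | zero => simp
  | add v w hv hw => rw [smul_add, map_add, map_add, hv, hw, smul_add]
  | tmul a x => rw [TensorProduct.smul_tmul']; exact (e x).map_smul c a

end Tensor

/-- A linear map into a matrix ring whose values on a spanning set are commuting nilpotents has
nilpotent values. -/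
theorem isNilpotent_of_span {V R : Type*} [AddCommGroup V] [Module K V] [Ring R] [Algebra K R]
    (E : V →ₗ[K] R) {s : Set V} (hs : Submodule.span K s = ⊤)
    (hcomm : ∀ a ∈ s, ∀ b ∈ s, Commute (E a) (E b)) (hnil : ∀ a ∈ s, IsNilpotent (E a)) (v : V) :
    IsNilpotent (E v) := by
  have h1 : ∀ a ∈ s, ∀ w, Commute (E a) (E w) := by
    intro a ha w
    have hw : w ∈ Submodule.span K s := hs ▸ Submodule.mem_top
    induction hw using Submodule.span_induction with
    | zero => simp
    | add a b _ _ ha hb => rw [map_add]; exact ha.add_right hb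
    | smul c a _ ha => rw [map_smul]; exact ha.smul_right c
    | mem b hb => exact hcomm a ha b hb
  have h2 : ∀ v w, Commute (E v) (E w) := by
    intro v w
    have hv : v ∈ Submodule.span K s := hs ▸ Submodule.mem_top
    induction hv using Submodule.span_induction with
    | zero => simp
    | add a b _ _ ha hb => rw [map_add]; exact ha.add_left hb
    | smul c a _ ha => rw [map_smul]; exact ha.smul_left c
    | mem b hb => exact h1 b hb w
  have hv : v ∈ Submodule.span K s := hs ▸ Submodule.mem_top
  induction hv using Submodule.span_induction with
  | zero => simp
  | add a b _ _ ha hb => rw [map_add]; exact (h2 a b).isNilpotent_add ha hb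
  | smul c a _ ha => rw [map_smul]; exact ha.smul c
  | mem b hb => exact hnil b hb

end AffineVariety

/-! ### Root subgroups indexed by pairs of matrix indices -/

namespace SpecialUnitary

section Roots

variable {k : Type u} {L : Type v} [Field k] [Field L] [Algebra k L] {n : ℕ}

/-- The index paired with `p` by the form. -/
def opp (p : Fin 2 × Fin n) : Fin 2 × Fin n := (1 - p.1, p.2)

/-- The sign `ε_p`, with `J e_p = ε_p e_{p'}` for the paired index `p'`. -/
def sgn (L : Type v) [Field L] (p : Fin 2 × Fin n) : L := if p.1 = 0 then 1 else -1

@[simp]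
theorem opp_opp (p : Fin 2 × Fin n) : opp (opp p) = p := by
  simp [opp]

@[simp]
theorem opp_snd (p : Fin 2 × Fin n) : (opp p).2 = p.2 := rfl

theorem opp_ne (p : Fin 2 × Fin n) : opp p ≠ p := by
  obtain ⟨a, b⟩ := p
  fin_cases a <;> simp [opp]

@[simp]
theorem sgn_opp (p : Fin 2 × Fin n) : sgn L (opp p) = -sgn L p := by
  obtain ⟨a, b⟩ := p
  fin_cases a <;> simp [opp, sgn]

@[simp]
theorem sgn_mul_self (p : Fin 2 × Fin n) : sgn L p * sgn L p = 1 := by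
  rw [sgn]; split_ifs <;> simp

@[simp]
theorem apply_sgn (τ : L ≃ₐ[k] L) (p : Fin 2 × Fin n) : τ (sgn L p) = sgn L p := by
  rw [sgn]; split_ifs <;> simp

theorem algebraMap_sgn (p : Fin 2 × Fin n) : algebraMap k L (sgn k p) = sgn L p := by
  rw [sgn, sgn]; split_ifs <;> simp

theorem formMatrix_mul_single (p q : Fin 2 × Fin n) (x : L) :
    formMatrix n L * Matrix.single p q x = Matrix.single (opp p) q (sgn L p * x) := by
  obtain ⟨a, i⟩ := p
  fin_cases a
  · simpa [opp, sgn] using formMatrix_mul_single_zero i q x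
  · simpa [opp, sgn, Matrix.single_neg] using formMatrix_mul_single_one i q x

theorem single_mul_formMatrix (p q : Fin 2 × Fin n) (x : L) :
    Matrix.single p q x * formMatrix n L = -Matrix.single p (opp q) (sgn L q * x) := by
  obtain ⟨a, i⟩ := q
  fin_cases a
  · simpa [opp, sgn] using single_zero_mul_formMatrix i p x
  · simpa [opp, sgn, Matrix.single_neg] using single_one_mul_formMatrix i p x

theorem ne_of_snd_ne {p q : Fin 2 × Fin n} (h : p.2 ≠ q.2) : p ≠ q := fun e => h (e ▸ rfl)

theorem sgn_eq_or (p : Fin 2 × Fin n) : sgn L p = 1 ∨ sgn L p = -1 := by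
  rw [sgn]; split_ifs <;> simp

/-- The matrix unit `E_{p,q}`. -/
def unitMat (L : Type v) [Field L] (p q : Fin 2 × Fin n) :
    Matrix (Fin 2 × Fin n) (Fin 2 × Fin n) L :=
  Matrix.single p q 1

theorem single_eq_smul (p q : Fin 2 × Fin n) (x : L) :
    Matrix.single p q x = x • unitMat L p q := by
  simp [unitMat, Matrix.smul_single]

@[simp]
theorem unitMat_mul_same (p q r : Fin 2 × Fin n) :
    unitMat L p q * unitMat L q r = unitMat L p r := by
  simp [unitMat]

theorem unitMat_mul_of_ne (p : Fin 2 × Fin n) {q r : Fin 2 × Fin n} (h : q ≠ r)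
    (s : Fin 2 × Fin n) : unitMat L p q * unitMat L r s = 0 :=
  Matrix.single_mul_single_of_ne (h := h) ..

theorem formMatrix_mul_unitMat (p q : Fin 2 × Fin n) :
    formMatrix n L * unitMat L p q = sgn L p • unitMat L (opp p) q := by
  rw [unitMat, formMatrix_mul_single, single_eq_smul, mul_one]

theorem unitMat_mul_formMatrix (p q : Fin 2 × Fin n) :
    unitMat L p q * formMatrix n L = -(sgn L q • unitMat L p (opp q)) := by
  rw [unitMat, single_mul_formMatrix, single_eq_smul, mul_one]

theorem conjTr_smul_unitMat (τ : L ≃ₐ[k] L) (p q : Fin 2 × Fin n) (x : L) :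
    conjTr τ (x • unitMat L p q) = τ x • unitMat L q p := by
  rw [← single_eq_smul, conjTr_single, single_eq_smul]

/-- The matrix `1 + E_{p,q}(x) - ε_p ε_q E_{q',p'}(x̄)`. -/
def rootMatrix (τ : L ≃ₐ[k] L) (p q : Fin 2 × Fin n) (x : L) :
    Matrix (Fin 2 × Fin n) (Fin 2 × Fin n) L :=
  1 + x • unitMat L p q + (-(sgn L p * sgn L q * τ x)) • unitMat L (opp q) (opp p)

theorem rootMatrix_det (τ : L ≃ₐ[k] L) {p q : Fin 2 × Fin n} (h : p.2 ≠ q.2) (x : L) :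
    (rootMatrix τ p q x).det = 1 := by
  rw [rootMatrix, ← single_eq_smul, ← single_eq_smul]
  exact det_one_add_single_add_single (ne_of_snd_ne h)
    (ne_of_snd_ne (by simpa using h.symm)) (opp_ne q).symm _ _

theorem rootMatrix_mem [Algebra.IsQuadraticExtension k L] (τ : L ≃ₐ[k] L) {p q : Fin 2 × Fin n}
    (h : p.2 ≠ q.2) (x : L) :
    conjTr τ (rootMatrix τ p q x) * formMatrix n L * rootMatrix τ p q x = formMatrix n L := by
  have h1 : p ≠ q := ne_of_snd_ne h
  have h4 : opp p ≠ opp q := ne_of_snd_ne h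
  simp only [rootMatrix, conjTr_add, conjTr_one, conjTr_smul_unitMat, add_mul, mul_add, one_mul,
    mul_one, smul_mul_assoc, mul_smul_comm, formMatrix_mul_unitMat, unitMat_mul_formMatrix,
    neg_mul, opp_opp, sgn_opp, unitMat_mul_of_ne, ne_eq, h4, h1.symm,
    opp_ne, (opp_ne _).symm, map_neg, map_mul, apply_sgn, apply_apply,
    not_false_eq_true, smul_zero]
  rcases sgn_eq_or (L := L) p with hp | hp <;> rcases sgn_eq_or (L := L) q with hq | hq <;>
    rw [hp, hq] <;> module

/-- The element of a short root subgroup given by two indices that are neither equal nor paired. -/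
def GShort [Algebra.IsQuadraticExtension k L] (τ : L ≃ₐ[k] L) (p q : Fin 2 × Fin n)
    (h : p.2 ≠ q.2) (x : L) : SU n τ :=
  ⟨⟨rootMatrix τ p q x, rootMatrix_det τ h x⟩, rootMatrix_mem τ h x⟩

/-- The matrix `1 + E_{p,p'}(y)`. -/
def rootMatrixLong (k : Type u) {L : Type v} [Field k] [Field L] [Algebra k L]
    (p : Fin 2 × Fin n) (y : k) : Matrix (Fin 2 × Fin n) (Fin 2 × Fin n) L :=
  1 + algebraMap k L y • unitMat L p (opp p)

/-- The element of the long root subgroup given by an index. -/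
def GLong (τ : L ≃ₐ[k] L) (p : Fin 2 × Fin n) (y : k) : SU n τ :=
  ⟨⟨rootMatrixLong k p y, by
    rw [rootMatrixLong, ← single_eq_smul]
    exact Matrix.det_transvection_of_ne _ _ (opp_ne p).symm _⟩, by
    change conjTr τ (rootMatrixLong k p y) * formMatrix n L * rootMatrixLong k p y = formMatrix n L
    simp only [rootMatrixLong, conjTr_add, conjTr_one, conjTr_smul_unitMat, add_mul, mul_add,
      one_mul, mul_one, smul_mul_assoc, mul_smul_comm, formMatrix_mul_unitMat,
      unitMat_mul_formMatrix, neg_mul, unitMat_mul_of_ne, ne_eq, opp_ne,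
      not_false_eq_true, smul_zero, AlgEquiv.commutes]
    module⟩

theorem SU_ext {τ : L ≃ₐ[k] L} {X Y : SU n τ} (h : X.1.1 = Y.1.1) : X = Y :=
  Subtype.ext (Subtype.ext h)

section Relations

variable [Algebra.IsQuadraticExtension k L] (τ : L ≃ₐ[k] L)

omit [Algebra.IsQuadraticExtension k L] in
theorem GLong_mul (p : Fin 2 × Fin n) (x y : k) :
    GLong τ p x * GLong τ p y = GLong τ p (x + y) := by
  refine SU_ext ?_
  change rootMatrixLong k p x * rootMatrixLong k p y = rootMatrixLong k p (x + y)
  simp only [rootMatrixLong, add_mul, mul_add, one_mul, mul_one, smul_mul_assoc, mul_smul_comm,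
    unitMat_mul_of_ne _ (opp_ne _), smul_zero, map_add]
  module

theorem GShort_mul {p q : Fin 2 × Fin n} (h : p.2 ≠ q.2) (x y : L) :
    GShort τ p q h x * GShort τ p q h y = GShort τ p q h (x + y) := by
  have h1 : p ≠ q := ne_of_snd_ne h
  have h4 : opp p ≠ opp q := ne_of_snd_ne h
  refine SU_ext ?_
  change rootMatrix τ p q x * rootMatrix τ p q y = rootMatrix τ p q (x + y)
  simp only [rootMatrix, add_mul, mul_add, one_mul, mul_one, smul_mul_assoc, mul_smul_comm,
    unitMat_mul_of_ne, ne_eq, h1.symm, h4, opp_ne, (opp_ne _).symm, not_false_eq_true,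
    smul_zero, map_add]
  module

/-- Commutator relation for α = ω_p + ω_q and β = -2ω_q: the factor for α + β is linear in x, while
the one for 2α + β involves the norm c of x. -/
theorem GShort_mul_GLong {p q : Fin 2 × Fin n} (h : p.2 ≠ q.2) (x : L) (y c : k)
    (hc : algebraMap k L c = x * τ x) :
    GShort τ p (opp q) h x * GLong τ (opp q) y =
      GLong τ (opp q) y * GShort τ p q h (y • x) * GLong τ p (-(sgn k p * sgn k q * c * y)) *
        GShort τ p (opp q) h x := by
  have h1 : p ≠ q := ne_of_snd_ne h
  have h2 : opp p ≠ q := ne_of_snd_ne h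
  have h4 : opp p ≠ opp q := ne_of_snd_ne h
  refine SU_ext ?_
  change rootMatrix τ p (opp q) x * rootMatrixLong k (opp q) y = rootMatrixLong k (opp q) y *
    rootMatrix τ p q (y • x) * rootMatrixLong k p (-(sgn k p * sgn k q * c * y)) *
    rootMatrix τ p (opp q) x
  rw [Algebra.smul_def]
  simp only [rootMatrix, rootMatrixLong, add_mul, mul_add, one_mul, mul_one, smul_mul_assoc,
    mul_smul_comm, unitMat_mul_of_ne, ne_eq, h2, h4, h1.symm,
    opp_ne, (opp_ne _).symm, not_false_eq_true, unitMat_mul_same, opp_opp,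
    smul_zero, zero_mul, map_neg, map_mul, hc, algebraMap_sgn, sgn_opp,
    AlgEquiv.commutes]
  rcases sgn_eq_or (L := L) p with hp | hp <;> rcases sgn_eq_or (L := L) q with hq | hq <;>
    rw [hp, hq] <;> module

/-- The roots ω_p + ω_q and ω_p - ω_q add up to 2ω_p. The commutator is a trace from L to k, whence
the factor 2 for arguments in k. -/
theorem GShort_mul_GShort_opp {p q : Fin 2 × Fin n} (h : p.2 ≠ q.2) (z y : k) :
    GShort τ p (opp q) h (algebraMap k L z) * GShort τ p q h (algebraMap k L y) =
      GShort τ p q h (algebraMap k L y) * GLong τ p (-(2 * sgn k p * sgn k q * z * y)) *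
        GShort τ p (opp q) h (algebraMap k L z) := by
  have h1 : p ≠ q := ne_of_snd_ne h
  have h2 : opp p ≠ q := ne_of_snd_ne h
  have h3 : p ≠ opp q := ne_of_snd_ne h
  have h4 : opp p ≠ opp q := ne_of_snd_ne h
  refine SU_ext ?_
  change rootMatrix τ p (opp q) (algebraMap k L z) * rootMatrix τ p q (algebraMap k L y) =
    rootMatrix τ p q (algebraMap k L y) * rootMatrixLong k p (-(2 * sgn k p * sgn k q * z * y)) *
    rootMatrix τ p (opp q) (algebraMap k L z)
  simp only [rootMatrix, rootMatrixLong, add_mul, mul_add, one_mul, mul_one, smul_mul_assoc,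
    mul_smul_comm, unitMat_mul_of_ne, ne_eq, h2, h4, h1.symm, h3.symm,
    opp_ne, not_false_eq_true, unitMat_mul_same, opp_opp,
    smul_zero, zero_mul, map_neg, map_mul, map_ofNat, algebraMap_sgn, sgn_opp,
    AlgEquiv.commutes]
  rcases sgn_eq_or (L := L) p with hp | hp <;> rcases sgn_eq_or (L := L) q with hq | hq <;>
    rw [hp, hq] <;> module

/-- Neither sum of the two roots concerned, ω_p - 3ω_q or 3ω_p - ω_q, is a root. -/
theorem GLong_commute_GShort {p q : Fin 2 × Fin n} (h : p.2 ≠ q.2) (y : k) (x : L) :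
    Commute (GLong τ (opp q) y) (GShort τ p q h x) ∧ Commute (GLong τ p y) (GShort τ p q h x) := by
  have h1 : p ≠ q := ne_of_snd_ne h
  have h4 : opp p ≠ opp q := ne_of_snd_ne h
  refine ⟨SU_ext ?_, SU_ext ?_⟩
  · change rootMatrixLong k (opp q) y * rootMatrix τ p q x =
      rootMatrix τ p q x * rootMatrixLong k (opp q) y
    simp only [rootMatrix, rootMatrixLong, add_mul, mul_add, one_mul, mul_one, smul_mul_assoc,
      mul_smul_comm, unitMat_mul_of_ne, ne_eq, h4, h1.symm,
      (opp_ne _).symm, not_false_eq_true, opp_opp, smul_zero]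
    module
  · change rootMatrixLong k p y * rootMatrix τ p q x = rootMatrix τ p q x * rootMatrixLong k p y
    simp only [rootMatrix, rootMatrixLong, add_mul, mul_add, one_mul, mul_one, smul_mul_assoc,
      mul_smul_comm, unitMat_mul_of_ne, ne_eq, h4, h1.symm,
      opp_ne, not_false_eq_true, smul_zero]
    module

omit [Algebra.IsQuadraticExtension k L] in
theorem GLong_commute_GLong {p q : Fin 2 × Fin n} (h : p.2 ≠ q.2) (x y : k) :
    Commute (GLong τ q x) (GLong τ p y) := by
  have h2 : opp p ≠ q := ne_of_snd_ne h
  have h3 : p ≠ opp q := ne_of_snd_ne h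
  refine SU_ext ?_
  change rootMatrixLong k q x * rootMatrixLong k p y = rootMatrixLong k p y * rootMatrixLong k q x
  simp only [rootMatrixLong, add_mul, mul_add, one_mul, mul_one, smul_mul_assoc,
    mul_smul_comm, unitMat_mul_of_ne, ne_eq, h2, h3.symm, not_false_eq_true, smul_zero]
  module

end Relations

/-! ### Torus action on the root subgroups -/

section Torus

/-- The diagonal entries of an element of the torus. -/
def torusDiag (t : Fin n → k) (p : Fin 2 × Fin n) : k := if p.1 = 0 then t p.2 else (t p.2)⁻¹

theorem torusDiag_opp (t : Fin n → k) (p : Fin 2 × Fin n) :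
    torusDiag t (opp p) = (torusDiag t p)⁻¹ := by
  obtain ⟨a, i⟩ := p
  fin_cases a <;> simp [torusDiag, opp]

/-- An element of the torus of diagonal matrices. -/
def torus (τ : L ≃ₐ[k] L) (t : Fin n → k) (ht : ∀ i, t i ≠ 0) : SU n τ :=
  ⟨⟨Matrix.diagonal fun p => algebraMap k L (torusDiag t p), by
    rw [Matrix.det_diagonal, ← map_prod, Fintype.prod_prod_type_right]
    simp [Fin.prod_univ_two, torusDiag, ht]⟩, by
    change conjTr τ (Matrix.diagonal fun p => algebraMap k L (torusDiag t p)) * formMatrix n L *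
      Matrix.diagonal (fun p => algebraMap k L (torusDiag t p)) = formMatrix n L
    have h : conjTr τ (Matrix.diagonal fun p : Fin 2 × Fin n => algebraMap k L (torusDiag t p)) =
        Matrix.diagonal fun p => algebraMap k L (torusDiag t p) := by
      rw [conjTr, Matrix.diagonal_transpose, Matrix.diagonal_map (map_zero τ)]
      simp
    rw [h]
    ext ⟨a, i⟩ ⟨b, j⟩
    rw [Matrix.mul_diagonal, Matrix.diagonal_mul]
    by_cases hij : i = j
    · subst hij
      have := ht i
      fin_cases a <;> fin_cases b <;>
        simp [formMatrix, Matrix.blockDiagonal_apply, torusDiag, this]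
    · simp [formMatrix, Matrix.blockDiagonal_apply, hij]⟩

theorem diagonal_mul_unitMat (d : Fin 2 × Fin n → L) (p q : Fin 2 × Fin n) :
    Matrix.diagonal d * unitMat L p q = d p • unitMat L p q := by
  ext a b
  by_cases h : p = a <;> simp [unitMat, Matrix.diagonal_mul, Matrix.single_apply, h]

theorem unitMat_mul_diagonal (d : Fin 2 × Fin n → L) (p q : Fin 2 × Fin n) :
    unitMat L p q * Matrix.diagonal d = d q • unitMat L p q := by
  ext a b
  by_cases h : q = b <;> simp [unitMat, Matrix.mul_diagonal, Matrix.single_apply, h]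

theorem exists_torus_GLong (τ : L ≃ₐ[k] L) (p : Fin 2 × Fin n) {s : k} (hs : s ≠ 0) :
    ∃ c : SU n τ, ∀ y, c * GLong τ p y = GLong τ p (s ^ 2 * y) * c := by
  obtain ⟨t, ht, hts⟩ : ∃ t : Fin n → k, (∀ i, t i ≠ 0) ∧ torusDiag t p = s := by
    refine ⟨fun _ => if p.1 = 0 then s else s⁻¹, fun i => ?_, ?_⟩
    · split_ifs <;> simp [hs]
    · rw [torusDiag]; split_ifs <;> simp
  refine ⟨torus τ t ht, fun y => SU_ext ?_⟩
  change Matrix.diagonal (fun p => algebraMap k L (torusDiag t p)) * rootMatrixLong k p y =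
    rootMatrixLong k p (s ^ 2 * y) * Matrix.diagonal (fun p => algebraMap k L (torusDiag t p))
  have hs' : algebraMap k L s ≠ 0 := by simpa using hs
  simp only [rootMatrixLong, mul_add, add_mul, mul_one, one_mul, mul_smul_comm, smul_mul_assoc,
    diagonal_mul_unitMat, unitMat_mul_diagonal, torusDiag_opp, hts, smul_smul, map_mul, map_pow,
    map_inv₀]
  congr 2
  field_simp

theorem exists_torus_GShort [Algebra.IsQuadraticExtension k L] (τ : L ≃ₐ[k] L)
    {p q : Fin 2 × Fin n} (h : p.2 ≠ q.2) {s : k} (hs : s ≠ 0) :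
    ∃ c : SU n τ, ∀ x, c * GShort τ p q h x = GShort τ p q h (s ^ 2 • x) * c := by
  -- The values s and s⁻¹ can be prescribed independently as p and q lie in different blocks; then
  -- ω_p - ω_q takes the value s², as in the long case.
  obtain ⟨t, ht, htp, htq⟩ : ∃ t : Fin n → k, (∀ i, t i ≠ 0) ∧ torusDiag t p = s ∧
      torusDiag t q = s⁻¹ := by
    refine ⟨fun i => if i = p.2 then (if p.1 = 0 then s else s⁻¹) else
      (if q.1 = 0 then s⁻¹ else s), fun i => ?_, ?_, ?_⟩
    · dsimp only; split_ifs <;> simp [hs]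
    · rw [torusDiag]; split_ifs <;> simp_all
    · rw [torusDiag]; split_ifs <;> simp_all
  refine ⟨torus τ t ht, fun x => SU_ext ?_⟩
  change Matrix.diagonal (fun p => algebraMap k L (torusDiag t p)) * rootMatrix τ p q x =
    rootMatrix τ p q (s ^ 2 • x) * Matrix.diagonal (fun p => algebraMap k L (torusDiag t p))
  have hs' : algebraMap k L s ≠ 0 := by simpa using hs
  rw [Algebra.smul_def]
  simp only [rootMatrix, mul_add, add_mul, mul_one, one_mul, mul_smul_comm, smul_mul_assoc,
    diagonal_mul_unitMat, unitMat_mul_diagonal, torusDiag_opp, htp, htq, smul_smul, map_inv₀,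
    inv_inv, map_mul, map_pow, AlgEquiv.commutes]
  congr 2
  · congr 1
    field_simp
  · field_simp

end Torus

/-- The Galois group has order 2, hence is {1, τ}, and τ swaps the two factors of the norm. -/
theorem exists_algebraMap_eq_mul_apply [CharZero k] [Algebra.IsQuadraticExtension k L]
    (τ : L ≃ₐ[k] L) (hτ : τ ≠ AlgEquiv.refl) (x : L) :
    ∃ c : k, algebraMap k L c = x * τ x := by
  have hfin : Module.finrank k L = 2 := Algebra.IsQuadraticExtension.finrank_eq_two k L
  have : FiniteDimensional k L := FiniteDimensional.of_finrank_pos (by omega)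
  have hcard : Fintype.card (L ≃ₐ[k] L) = 2 := by
    rw [← Nat.card_eq_fintype_card, IsGalois.card_aut_eq_finrank, hfin]
  refine (IsGalois.mem_range_algebraMap_iff_fixed (F := k) (x * τ x)).2 fun σ => ?_
  by_cases h1 : σ = 1
  · rw [h1]; rfl
  by_cases h2 : σ = τ
  · rw [h2, map_mul, apply_apply, mul_comm]
  · classical
    have h3 : ({1, τ, σ} : Finset (L ≃ₐ[k] L)).card = 3 :=
      Finset.card_eq_three.2 ⟨1, τ, σ, Ne.symm hτ, Ne.symm h1, Ne.symm h2, rfl⟩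
    have := Finset.card_le_univ ({1, τ, σ} : Finset (L ≃ₐ[k] L))
    omega

theorem XLong_eq_GLong (τ : L ≃ₐ[k] L) (α : LongRoot n) :
    ∃ p, ∀ x, XLong τ α x = GLong τ p x := by
  cases α with
  | pos i => exact ⟨(0, i), fun x => SU_ext (congrArg (1 + ·) (single_eq_smul _ _ _))⟩
  | neg i => exact ⟨(1, i), fun x => SU_ext (congrArg (1 + ·) (single_eq_smul _ _ _))⟩

theorem XShort_eq_GShort [Algebra.IsQuadraticExtension k L] (τ : L ≃ₐ[k] L) (α : ShortRoot n) :
    ∃ (p q : Fin 2 × Fin n) (h : p.2 ≠ q.2), ∀ x, XShort τ α x = GShort τ p q h x := by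
  cases α with
  | sub i j h =>
    refine ⟨(0, i), (0, j), h, fun x => SU_ext ?_⟩
    change shortMatrix τ (.sub i j h) x = rootMatrix τ (0, i) (0, j) x
    simp [shortMatrix, rootMatrix, single_eq_smul, sgn, opp, sub_eq_add_neg]
  | add i j h =>
    refine ⟨(0, i), (1, j), h.ne, fun x => SU_ext ?_⟩
    change shortMatrix τ (.add i j h) x = rootMatrix τ (0, i) (1, j) x
    simp [shortMatrix, rootMatrix, single_eq_smul, sgn, opp]
  | negAdd i j h =>
    refine ⟨(1, j), (0, i), h.ne', fun x => SU_ext ?_⟩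
    change shortMatrix τ (.negAdd i j h) x = rootMatrix τ (1, j) (0, i) x
    simp [shortMatrix, rootMatrix, single_eq_smul, sgn, opp]

end Roots
end SpecialUnitary

/-! ### Logarithms in a representation -/

section LogRep

variable {K : Type w} [Field K] [CharZero K] {m : ℕ} {G : Type*} [Group G]
  (ρ : G →* GL (Fin m) K)

/-- The element `g` acts unipotently in the representation `ρ`. -/
def IsUnipotentIn (g : G) : Prop := ((ρ g).val - 1) ^ m = 0

/-- The logarithm of `ρ g`, meaningful if `g` acts unipotently. -/
noncomputable def logRep (g : G) : Matrix (Fin m) (Fin m) K := IsNilpotent.logTrunc m (ρ g).val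

/-- Conjugation by `ρ c` on matrices. -/
def adRep (c : G) : Matrix (Fin m) (Fin m) K →ₗ[K] Matrix (Fin m) (Fin m) K :=
  LinearMap.mulRight K (ρ c⁻¹).val ∘ₗ LinearMap.mulLeft K (ρ c).val

variable {ρ}

omit [CharZero K] in
theorem isUnipotentIn_of_conj [IsAlgClosed K] {g : G}
    (h : ∀ t : ℕ, 0 < t → ∃ c : G, c * g * c⁻¹ = g ^ (t ^ 2)) : IsUnipotentIn ρ g := by
  refine Matrix.sub_one_pow_eq_zero_of_conj (ρ g) fun t ht => ?_
  obtain ⟨c, hc⟩ := h t ht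
  exact ⟨ρ c, by rw [← map_inv, ← map_mul, ← map_mul, hc, map_pow]⟩

theorem exp_logRep {g : G} (hg : IsUnipotentIn ρ g) : IsNilpotent.exp (logRep ρ g) = (ρ g).val :=
  IsNilpotent.exp_logTrunc hg

theorem isNilpotent_logRep {g : G} (hg : IsUnipotentIn ρ g) : IsNilpotent (logRep ρ g) :=
  ⟨m, IsNilpotent.isNilpotent_logTrunc hg⟩

theorem commute_logRep {g h : G} (hgh : Commute g h) : Commute (logRep ρ g) (logRep ρ h) := by
  have h1 : Commute (ρ g).val (ρ h).val := congrArg Units.val (hgh.map ρ).eq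
  rw [logRep, logRep, IsNilpotent.logTrunc, IsNilpotent.logTrunc]
  refine Commute.sum_left _ _ _ fun i _ => Commute.sum_right _ _ _ fun j _ => ?_
  have h2 : Commute ((ρ g).val - 1) ((ρ h).val - 1) :=
    (h1.sub_left (Commute.one_left _)).sub_right
      ((Commute.one_right _).sub_left (Commute.one_left _))
  exact ((h2.pow_pow i j).smul_left _).smul_right _

theorem logRep_eq {g : G} {a : Matrix (Fin m) (Fin m) K} (ha : IsNilpotent a)
    (h : IsNilpotent.exp a = (ρ g).val) : logRep ρ g = a := by
  rw [logRep, ← h, IsNilpotent.logTrunc_exp (Matrix.pow_eq_zero_of_isNilpotent ha)]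

theorem logRep_mul {g h : G} (hgh : Commute g h) (hg : IsUnipotentIn ρ g)
    (hh : IsUnipotentIn ρ h) : logRep ρ (g * h) = logRep ρ g + logRep ρ h := by
  have hc := commute_logRep (ρ := ρ) hgh
  refine logRep_eq (hc.isNilpotent_add (isNilpotent_logRep hg) (isNilpotent_logRep hh)) ?_
  rw [IsNilpotent.exp_add_of_commute hc (isNilpotent_logRep hg) (isNilpotent_logRep hh),
    exp_logRep hg, exp_logRep hh, map_mul, Units.val_mul]

omit [CharZero K] in
theorem IsUnipotentIn.mul {g h : G} (hgh : Commute g h) (hg : IsUnipotentIn ρ g)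
    (hh : IsUnipotentIn ρ h) : IsUnipotentIn ρ (g * h) := by
  have h1 : Commute (ρ g).val (ρ h).val := congrArg Units.val (hgh.map ρ).eq
  refine Matrix.pow_eq_zero_of_isNilpotent ?_
  have e : (ρ (g * h)).val - 1 = ((ρ g).val - 1) * (ρ h).val + ((ρ h).val - 1) := by
    rw [map_mul, Units.val_mul, sub_mul, one_mul, sub_add_sub_cancel]
  have c1 : Commute ((ρ g).val - 1) (ρ h).val := h1.sub_left (Commute.one_left _)
  have c2 : Commute (((ρ g).val - 1) * (ρ h).val) ((ρ h).val - 1) :=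
    (c1.sub_right (Commute.one_right _)).mul_left
      ((Commute.refl _).sub_right (Commute.one_right _))
  rw [e]
  exact c2.isNilpotent_add (c1.isNilpotent_mul_right ⟨m, hg⟩) ⟨m, hh⟩

/-- The logarithm is a polynomial, so it commutes with conjugation. -/
theorem adRep_logRep (c g : G) : adRep ρ c (logRep ρ g) = logRep ρ (c * g * c⁻¹) := by
  have hinv : (ρ c⁻¹).val * (ρ c).val = 1 := by
    rw [← Units.val_mul, ← map_mul, inv_mul_cancel, map_one, Units.val_one]
  have hinv' : (ρ c).val * (ρ c⁻¹).val = 1 := by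
    rw [← Units.val_mul, ← map_mul, mul_inv_cancel, map_one, Units.val_one]
  have hpow : ∀ (a : Matrix (Fin m) (Fin m) K) (j : ℕ), (ρ c).val * a ^ j * (ρ c⁻¹).val =
      ((ρ c).val * a * (ρ c⁻¹).val) ^ j := by
    intro a j
    induction j with
    | zero => simp
    | succ j ih =>
      rw [pow_succ, pow_succ, ← ih]
      simp only [mul_assoc]
      rw [← mul_assoc (ρ c⁻¹).val (ρ c).val, hinv, one_mul]
  simp only [adRep, logRep, IsNilpotent.logTrunc, LinearMap.comp_apply, LinearMap.mulLeft_apply,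
    LinearMap.mulRight_apply, Finset.mul_sum, Finset.sum_mul, mul_smul_comm, smul_mul_assoc, hpow,
    map_mul, Units.val_mul, mul_sub, sub_mul, mul_one, hinv']

end LogRep

/-! ### Linear operators relating the logarithms of the root subgroups -/

namespace SpecialUnitary

variable {k : Type u} {L : Type v} [Field k] [CharZero k] [Field L] [Algebra k L]
  [Algebra.IsQuadraticExtension k L] {τ : L ≃ₐ[k] L}
  {K : Type w} [Field K] [IsAlgClosed K] {n m : ℕ} (ρ : SU n τ →* GL (Fin m) K)

omit [CharZero k] [Algebra.IsQuadraticExtension k L] in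
theorem GLong_zero (p : Fin 2 × Fin n) : GLong τ p (0 : k) = 1 := by
  simpa using GLong_mul τ p (0 : k) 0

omit [CharZero k] in
theorem GShort_zero {p q : Fin 2 × Fin n} (h : p.2 ≠ q.2) : GShort τ p q h 0 = 1 := by
  simpa using GShort_mul τ h 0 0

omit [CharZero k] [Algebra.IsQuadraticExtension k L] in
theorem GLong_pow (p : Fin 2 × Fin n) (y : k) (d : ℕ) : GLong τ p y ^ d = GLong τ p (d * y) := by
  induction d with
  | zero => simp [GLong_zero]
  | succ d ih => rw [pow_succ, ih, GLong_mul]; push_cast; ring_nf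

omit [CharZero k] in
theorem GShort_pow {p q : Fin 2 × Fin n} (h : p.2 ≠ q.2) (x : L) (d : ℕ) :
    GShort τ p q h x ^ d = GShort τ p q h ((d : k) • x) := by
  induction d with
  | zero => simp [GShort_zero]
  | succ d ih => rw [pow_succ, ih, GShort_mul]; push_cast; rw [add_smul, one_smul]

omit [Algebra.IsQuadraticExtension k L] in
theorem isUnipotentIn_GLong (p : Fin 2 × Fin n) (y : k) : IsUnipotentIn ρ (GLong τ p y) := by
  refine isUnipotentIn_of_conj fun t ht => ?_
  obtain ⟨c, hc⟩ := exists_torus_GLong τ p (s := (t : k)) (by exact_mod_cast ht.ne')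
  exact ⟨c, by rw [hc, mul_inv_cancel_right, GLong_pow]; push_cast; rfl⟩

theorem isUnipotentIn_GShort {p q : Fin 2 × Fin n} (h : p.2 ≠ q.2) (x : L) :
    IsUnipotentIn ρ (GShort τ p q h x) := by
  refine isUnipotentIn_of_conj fun t ht => ?_
  obtain ⟨c, hc⟩ := exists_torus_GShort τ h (s := (t : k)) (by exact_mod_cast ht.ne')
  exact ⟨c, by rw [hc, mul_inv_cancel_right, GShort_pow]; push_cast; rfl⟩

omit [CharZero k] [Algebra.IsQuadraticExtension k L] in
theorem GLong_commute (p : Fin 2 × Fin n) (x y : k) : Commute (GLong τ p x) (GLong τ p y) := by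
  rw [Commute, SemiconjBy, GLong_mul, GLong_mul, add_comm]

omit [CharZero k] in
theorem GShort_commute {p q : Fin 2 × Fin n} (h : p.2 ≠ q.2) (x y : L) :
    Commute (GShort τ p q h x) (GShort τ p q h y) := by
  rw [Commute, SemiconjBy, GShort_mul, GShort_mul, add_comm]

variable [CharZero K]

/-- The additive map `y ↦ log ρ(X_α(y))` for a long root. -/
noncomputable def logLong (p : Fin 2 × Fin n) : k →+ Matrix (Fin m) (Fin m) K :=
  AddMonoidHom.mk' (fun y => logRep ρ (GLong τ p y)) fun x y => by
    rw [← GLong_mul, logRep_mul (GLong_commute p x y) (isUnipotentIn_GLong ρ p x)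
      (isUnipotentIn_GLong ρ p y)]

/-- The additive map `x ↦ log ρ(X_α(x))` for a short root. -/
noncomputable def logShort {p q : Fin 2 × Fin n} (h : p.2 ≠ q.2) :
    L →+ Matrix (Fin m) (Fin m) K :=
  AddMonoidHom.mk' (fun x => logRep ρ (GShort τ p q h x)) fun x y => by
    rw [← GShort_mul, logRep_mul (GShort_commute h x y) (isUnipotentIn_GShort ρ h x)
      (isUnipotentIn_GShort ρ h y)]

/-- The three factors that the commutator relation produces commute pairwise, so the logarithm turns
their product into a sum. -/
theorem adRep_logLong {p q : Fin 2 × Fin n} (h : p.2 ≠ q.2) (x : L) (y c : k)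
    (hc : algebraMap k L c = x * τ x) :
    adRep ρ (GShort τ p (opp q) h x) (logLong ρ (opp q) y) =
      logLong ρ (opp q) y + logShort ρ h (y • x) +
        logLong ρ p (-(sgn k p * sgn k q * c * y)) := by
  have h1 := GLong_commute_GShort τ h y (y • x)
  have h2 := (GLong_commute_GShort τ h (-(sgn k p * sgn k q * c * y)) (y • x)).2
  have h3 := GLong_commute_GLong τ (q := opp q) h y (-(sgn k p * sgn k q * c * y))
  refine (adRep_logRep _ _).trans ?_
  rw [GShort_mul_GLong τ h x y c hc, mul_inv_cancel_right,
    logRep_mul (h3.mul_left h2.symm)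
      ((isUnipotentIn_GLong ρ _ _).mul h1.1 (isUnipotentIn_GShort ρ _ _))
      (isUnipotentIn_GLong ρ _ _),
    logRep_mul h1.1 (isUnipotentIn_GLong ρ _ _) (isUnipotentIn_GShort ρ _ _)]
  rfl

theorem adRep_logShort {p q : Fin 2 × Fin n} (h : p.2 ≠ q.2) (z y : k) :
    adRep ρ (GShort τ p (opp q) h (algebraMap k L z)) (logShort ρ h (algebraMap k L y)) =
      logShort ρ h (algebraMap k L y) + logLong ρ p (-(2 * sgn k p * sgn k q * z * y)) := by
  have h2 := (GLong_commute_GShort τ h (-(2 * sgn k p * sgn k q * z * y)) (algebraMap k L y)).2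
  refine (adRep_logRep _ _).trans ?_
  rw [GShort_mul_GShort_opp τ h z y, mul_inv_cancel_right,
    logRep_mul h2.symm (isUnipotentIn_GShort ρ _ _) (isUnipotentIn_GLong ρ _ _)]
  rfl

/-- Of the three terms in `adRep_logLong` only the short one is odd in x; half the difference of the
operators for x and -x isolates it. -/
theorem exists_linear_logLong_opp_logShort (hτ : τ ≠ AlgEquiv.refl) {p q : Fin 2 × Fin n}
    (h : p.2 ≠ q.2) (x : L) : ∃ T : Matrix (Fin m) (Fin m) K →ₗ[K] Matrix (Fin m) (Fin m) K,
      ∀ y : k, T (logLong ρ (opp q) y) = logShort ρ h (y • x) := by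
  obtain ⟨c, hc⟩ := exists_algebraMap_eq_mul_apply τ hτ x
  refine ⟨(2⁻¹ : K) • (adRep ρ (GShort τ p (opp q) h x) - adRep ρ (GShort τ p (opp q) h (-x))),
    fun y => ?_⟩
  rw [LinearMap.smul_apply, LinearMap.sub_apply, adRep_logLong ρ h x y c hc,
    adRep_logLong ρ h (-x) y c (by rw [hc, map_neg, neg_mul_neg]), smul_neg,
    map_neg (logShort ρ h)]
  module

theorem exists_linear_logShort_logLong {p q : Fin 2 × Fin n} (h : p.2 ≠ q.2) :
    ∃ T : Matrix (Fin m) (Fin m) K →ₗ[K] Matrix (Fin m) (Fin m) K,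
      ∀ y : k, T (logShort ρ h (algebraMap k L y)) = logLong ρ p y := by
  -- This argument cancels the constant -2 ε_p ε_q of the commutator, since the signs square to 1.
  refine ⟨adRep ρ (GShort τ p (opp q) h (algebraMap k L (-(sgn k p * sgn k q) / 2))) -
    LinearMap.id, fun y => ?_⟩
  rw [LinearMap.sub_apply, adRep_logShort, LinearMap.id_apply, add_sub_cancel_left]
  congr 1
  have hp := sgn_mul_self (L := k) p
  have hq := sgn_mul_self (L := k) q
  field_simp
  linear_combination (sgn k p) ^ 2 * y * hq + y * hp

/-- From 2ω_p one reaches 2ω_q through the short root ω_p + ω_q when p and q lie in different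
blocks. Within one block the path detours through another, which exists because n ≥ 2. -/
theorem exists_linear_logLong_logLong (hτ : τ ≠ AlgEquiv.refl) (hn : 2 ≤ n)
    (p q : Fin 2 × Fin n) (x : k) :
    ∃ T : Matrix (Fin m) (Fin m) K →ₗ[K] Matrix (Fin m) (Fin m) K,
      ∀ y : k, T (logLong ρ p y) = logLong ρ q (x * y) := by
  have key : ∀ (p q : Fin 2 × Fin n), q.2 ≠ p.2 → ∀ x : k,
      ∃ T : Matrix (Fin m) (Fin m) K →ₗ[K] Matrix (Fin m) (Fin m) K,
        ∀ y : k, T (logLong ρ p y) = logLong ρ q (x * y) := by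
    intro p q h x
    obtain ⟨T, hT⟩ := exists_linear_logLong_opp_logShort ρ hτ (p := q) (q := opp p) h
      (algebraMap k L x)
    obtain ⟨S, hS⟩ := exists_linear_logShort_logLong ρ (p := q) (q := opp p) h
    refine ⟨S ∘ₗ T, fun y => ?_⟩
    rw [opp_opp] at hT
    rw [LinearMap.comp_apply, hT, Algebra.smul_def, ← map_mul, hS, mul_comm]
  by_cases h : q.2 = p.2
  · have : Nontrivial (Fin n) := Fin.nontrivial_iff_two_le.2 hn
    obtain ⟨i, hi⟩ := exists_ne p.2
    obtain ⟨T, hT⟩ := key p (0, i) hi x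
    obtain ⟨S, hS⟩ := key (0, i) q (by rw [h]; exact hi.symm) 1
    exact ⟨S ∘ₗ T, fun y => by rw [LinearMap.comp_apply, hT, hS, one_mul]⟩
  · exact key p q h x

end SpecialUnitary

/-! ### Construction of A and of the maps ψ_α -/

open SpecialUnitary AffineVariety in
theorem proposition3p4 {k : Type u} {L : Type v} {K : Type w}
    [Field k] [CharZero k] [Field L] [Algebra k L] [Algebra.IsQuadraticExtension k L]
    (τ : L ≃ₐ[k] L) (hτ : τ ≠ AlgEquiv.refl)
    [Field K] [IsAlgClosed K] [CharZero K]
    (n : ℕ) (hn : 2 ≤ n) (m : ℕ) (ρ : SU n τ →* GL (Fin m) K) :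
    ∃ (A : Type w) (_ : CommRing A) (_ : Algebra K A) (f : k →+* A),
      Module.Finite K A ∧
      zariskiClosure (regVec K A) (Set.range f) = Set.univ ∧
      letI : Algebra k A := f.toAlgebra
      -- the regular maps `ψ_α : V_α(A) → H`; here `V_α(A) = A` for `α` long
      -- and `V_α(A) = A ⊗[k] L` for `α` short, so that `V_α(f) : V_α(k) → V_α(A)` is
      -- `x ↦ f x` on `V_α(k) = k`, respectively `x ↦ 1 ⊗ₜ x` on `V_α(k) = L`
      ∃ (ψlong : LongRoot n → A → GL (Fin m) K) (ψshort : ShortRoot n → A ⊗[k] L → GL (Fin m) K),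
        (∀ α : LongRoot n,
          IsRegularMap (regVec K A) (regGL K m) (ψlong α) ∧
          (∀ a : A, ψlong α a ∈ zariskiClosure (regGL K m) (Set.range ρ)) ∧
          (∀ x : k, ψlong α (f x) = ρ (XLong τ α x)) ∧
          IsIsoOnto (regVec K A) (regGL K m) (ψlong α)
            (zariskiClosure (regGL K m) (Set.range fun x : k => ρ (XLong τ α x)))) ∧
        (∀ α : ShortRoot n,
          IsRegularMap (regVec K (A ⊗[k] L)) (regGL K m) (ψshort α) ∧
          (∀ a : A ⊗[k] L, ψshort α a ∈ zariskiClosure (regGL K m) (Set.range ρ)) ∧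
          (∀ x : L, ψshort α (1 ⊗ₜ[k] x) = ρ (XShort τ α x)) ∧
          IsIsoOnto (regVec K A) (regGL K m) (fun a : A => ψshort α (a ⊗ₜ[k] (1 : L)))
            (zariskiClosure (regGL K m)
              (Set.range fun x : k => ρ (XShort τ α (algebraMap k L x))))) := by
  let p₀ : Fin 2 × Fin n := (0, ⟨0, by omega⟩)
  obtain ⟨A, iA, iKA, f, e, hfin, hspan, hinj, hef⟩ :=
    exists_algebra_of_additive_map (logLong ρ p₀)
      (exists_linear_logLong_logLong ρ hτ hn p₀ p₀)
  refine ⟨A, iA, iKA, f, hfin, zariskiClosure_range_eq_univ (f : k →+ A) hspan, ?_⟩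
  let : Algebra k A := f.toAlgebra
  have hext : ∀ φ : A →ₗ[K] Matrix (Fin m) (Fin m) K, (∀ y, φ (f y) = e (f y)) → φ = e :=
    fun φ h => LinearMap.ext_on hspan (by rintro _ ⟨y, rfl⟩; exact h y)
  have hlong : ∀ α : LongRoot n, ∃ ψ : A → GL (Fin m) K,
      IsRegularMap (regVec K A) (regGL K m) ψ ∧
      (∀ a : A, ψ a ∈ zariskiClosure (regGL K m) (Set.range ρ)) ∧
      (∀ x : k, ψ (f x) = ρ (XLong τ α x)) ∧
      IsIsoOnto (regVec K A) (regGL K m) ψ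
        (zariskiClosure (regGL K m) (Set.range fun x : k => ρ (XLong τ α x))) := by
    intro α
    obtain ⟨p, hp⟩ := XLong_eq_GLong τ α
    simp only [hp]
    obtain ⟨T, hT⟩ := exists_linear_logLong_logLong ρ hτ hn p₀ p 1
    obtain ⟨S, hS⟩ := exists_linear_logLong_logLong ρ hτ hn p p₀ 1
    simp only [one_mul] at hT hS
    let E := T ∘ₗ e
    have hE : ∀ y, E (f y) = logLong ρ p y := fun y => by rw [LinearMap.comp_apply, hef, hT]
    have hnil : ∀ a, IsNilpotent (E a) := by
      refine isNilpotent_of_span E hspan ?_ ?_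
      · rintro _ ⟨x, rfl⟩ _ ⟨y, rfl⟩
        rw [hE, hE]
        exact commute_logRep (GLong_commute p x y)
      · rintro _ ⟨x, rfl⟩
        rw [hE]
        exact isNilpotent_logRep (isUnipotentIn_GLong ρ p x)
    have hEinj : Function.Injective E := by
      -- The operator going back to the base root recovers e, so E inherits its injectivity.
      have : S ∘ₗ E = e := hext _ fun y => by rw [LinearMap.comp_apply, hE, hS, hef]
      refine Function.Injective.of_comp (f := S) ?_
      rw [← LinearMap.coe_comp, this]
      exact hinj
    have hψ : ∀ x, expGL (E (f x)) (hnil (f x)) = ρ (GLong τ p x) := fun x => Units.ext <| by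
      change IsNilpotent.exp (E (f x)) = _
      rw [hE]
      exact exp_logRep (isUnipotentIn_GLong ρ p x)
    refine ⟨fun a => expGL (E a) (hnil a), isRegularMap_expGL E hnil, ?_, hψ,
      isIsoOnto_expGL E hnil (f : k →+ A) hspan _ hψ hEinj⟩
    exact expGL_mem_zariskiClosure E hnil (f : k →+ A) hspan _ hψ
      (by rintro _ ⟨x, rfl⟩; exact ⟨_, rfl⟩)
  have hshort : ∀ α : ShortRoot n, ∃ ψ : A ⊗[k] L → GL (Fin m) K,
      IsRegularMap (regVec K (A ⊗[k] L)) (regGL K m) ψ ∧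
      (∀ a : A ⊗[k] L, ψ a ∈ zariskiClosure (regGL K m) (Set.range ρ)) ∧
      (∀ x : L, ψ (1 ⊗ₜ[k] x) = ρ (XShort τ α x)) ∧
      IsIsoOnto (regVec K A) (regGL K m) (fun a : A => ψ (a ⊗ₜ[k] (1 : L)))
        (zariskiClosure (regGL K m)
          (Set.range fun x : k => ρ (XShort τ α (algebraMap k L x)))) := by
    intro α
    obtain ⟨p, q, h, hpq⟩ := XShort_eq_GShort τ α
    simp only [hpq]
    obtain ⟨T, hT⟩ := exists_linear_logLong_logLong ρ hτ hn p₀ (opp q) 1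
    obtain ⟨S, hS⟩ := exists_linear_logShort_logLong ρ h
    obtain ⟨R, hR⟩ := exists_linear_logLong_logLong ρ hτ hn p p₀ 1
    simp only [one_mul] at hT hR
    -- For fixed x, the map N(yx) of y factors linearly through A: pass from the base root to the
    -- long root of `opp q`, then to the short root.
    obtain ⟨E, hE⟩ := exists_tensor_lift (K := K) (A := A) hspan (logShort ρ h) fun x => by
      obtain ⟨U, hU⟩ := exists_linear_logLong_opp_logShort ρ hτ h x
      exact ⟨U ∘ₗ T ∘ₗ e, fun y => by
        rw [LinearMap.comp_apply, LinearMap.comp_apply, ← hU, ← hT]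
        exact congrArg (fun z => U (T z)) (hef y)⟩
    have hE1 : ∀ x : L, E (1 ⊗ₜ x) = logShort ρ h x := fun x => by
      simpa using hE 1 x
    have hspan' := span_range_one_tmul (K := K) (L := L) (A := A) hspan
    let ι : L →+ A ⊗[k] L := (TensorProduct.mk k A L 1).toAddMonoidHom
    have hnil : ∀ a, IsNilpotent (E a) := by
      refine isNilpotent_of_span E hspan' ?_ ?_
      · rintro _ ⟨x, rfl⟩ _ ⟨y, rfl⟩
        rw [hE1, hE1]
        exact commute_logRep (GShort_commute h x y)
      · rintro _ ⟨x, rfl⟩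
        rw [hE1]
        exact isNilpotent_logRep (isUnipotentIn_GShort ρ h x)
    have hψ : ∀ x, expGL (E (1 ⊗ₜ x)) (hnil (1 ⊗ₜ x)) = ρ (GShort τ p q h x) :=
      fun x => Units.ext <| by
        change IsNilpotent.exp (E (1 ⊗ₜ x)) = _
        rw [hE1]
        exact exp_logRep (isUnipotentIn_GShort ρ h x)
    let E₁ : A →ₗ[K] Matrix (Fin m) (Fin m) K :=
      { toFun := fun a => E (a ⊗ₜ 1)
        map_add' := fun a b => by rw [TensorProduct.add_tmul, map_add]
        map_smul' := fun c a => by rw [← TensorProduct.smul_tmul', map_smul]; rfl }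
    have hE₁ : ∀ y, E₁ (f y) = logShort ρ h (algebraMap k L y) := fun y => by
      rw [Algebra.algebraMap_eq_smul_one]; exact hE y 1
    have hE₁inj : Function.Injective E₁ := by
      -- Here S leads from the short root, on arguments from k, to the long root of p, and R leads
      -- on to the base root. This gives injectivity on A ⊗ 1 only.
      have : (R ∘ₗ S) ∘ₗ E₁ = e := hext _ fun y => by
        rw [LinearMap.comp_apply, LinearMap.comp_apply, hE₁, hS, hR, hef]
      refine Function.Injective.of_comp (f := R ∘ₗ S) ?_
      rw [← LinearMap.coe_comp, this]
      exact hinj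
    refine ⟨fun a => expGL (E a) (hnil a), isRegularMap_expGL E hnil, ?_, hψ, ?_⟩
    · exact expGL_mem_zariskiClosure E hnil ι hspan' _ hψ
        (by rintro _ ⟨x, rfl⟩; exact ⟨_, rfl⟩)
    · refine isIsoOnto_expGL E₁ (fun a => hnil (a ⊗ₜ 1)) (f : k →+ A) hspan _ (fun x => ?_) hE₁inj
      refine Units.ext ?_
      change IsNilpotent.exp (E₁ (f x)) = _
      rw [hE₁]
      exact exp_logRep (isUnipotentIn_GShort ρ h _)
  choose ψlong hψlong using hlong
  choose ψshort hψshort using hshort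
  exact ⟨ψlong, ψshort, hψlong, hψshort⟩
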